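/- Let $H$ be a separable complex Hilbert space, $\mathcal B(H)$ the algebra of bounded linear operators on $H$, $\mathcal K(H)$ the ideal of compact operators, $\mathcal C(H)=\mathcal B(H)/\mathcal K(H)$ the Calkin algebra with its quotient norm and involution, and $\pi:\mathcal B(H)\to\mathcal C(H)$ the quotient map. Let $\mathcal P$ be the set of selfadjoint projections of $\mathcal C(H)$, i.e. of $p\in\mathcal C(H)$ with $p=p^*=p^2$. A geodesic of $\mathcal P$ is a curve $\delta(t)=e^{tz}\,p_0\,e^{-tz}$ with $p_0\in\mathcal P$, $z\in\mathcal C(H)$, $z^*=-z$ and $p_0zp_0=(1-p_0)z(1-p_0)=0$. For $p,q\in\mathcal P$, a minimal geodesic joining $p$ and $q$ is a geodesic $\delta$, considered on $[0,1]$, with $\delta(0)=p$, $\delta(1)=q$ and $$\int_0^1\|\dot\delta(t)\|\,dt\;\le\;\int_a^b\|\dot\gamma(t)\|\,dt$$ for every $a<b$ and every continuous, piecewise $C^1$ curve $\gamma:[a,b]\to\mathcal P\subset\mathcal C(H)$ with $\gamma(a)=p$ and $\gamma(b)=q$. **Proposition.** Let $p,q\in\mathcal P$. Suppose that there exist orthogonal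 projections $P,Q\in\mathcal B(H)$ with $\pi(P)=p$, $\pi(Q)=q$ such that the null spaces $N(P-Q-1)$ and $N(P-Q+1)$ are both infinite-dimensional. Then there exist infinitely many distinct minimal geodesics $\delta:[0,1]\to\mathcal P$ joining $p$ and $q$. -/

import Mathlib

open scoped ENNReal

noncomputable section

/-! ### The Calkin algebra -/

section Calkin

variable (H : Type*) [NormedAddCommGroup H] [InnerProductSpace ℂ H]

/-- The two-sided ideal `K(H)` of compact operators in `B(H)`. -/
def compactIdeal : Ideal (H →L[ℂ] H) where
  carrier := {T | IsCompactOperator T}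
  add_mem' hS hT := hS.add hT
  zero_mem' := isCompactOperator_zero
  smul_mem' S _ hT := hT.clm_comp S

instance compactIdeal_isTwoSided : (compactIdeal H).IsTwoSided :=
  ⟨fun S hT => IsCompactOperator.comp_clm hT S⟩

/-- The Calkin algebra `B(H) / K(H)`, with the quotient norm and the quotient involution. -/
def Calkin : Type _ := (H →L[ℂ] H) ⧸ compactIdeal H

instance : Ring (Calkin H) := inferInstanceAs (Ring ((H →L[ℂ] H) ⧸ compactIdeal H))

instance : Algebra ℂ (Calkin H) := inferInstanceAs (Algebra ℂ ((H →L[ℂ] H) ⧸ compactIdeal H))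

/-- The quotient map `π : B(H) → B(H) / K(H)`. -/
def Calkin.mk : (H →L[ℂ] H) →ₐ[ℂ] Calkin H := Ideal.Quotient.mkₐ ℂ (compactIdeal H)

variable {H}

theorem Calkin.mk_surjective : Function.Surjective (Calkin.mk H) :=
  Ideal.Quotient.mkₐ_surjective ℂ (compactIdeal H)

theorem Calkin.mk_eq_mk_iff {S T : H →L[ℂ] H} :
    Calkin.mk H S = Calkin.mk H T ↔ IsCompactOperator (S - T) :=
  Ideal.Quotient.mk_eq_mk_iff_sub_mem (I := compactIdeal H) S T

/-- The quotient norm `‖π(T)‖ = inf {‖T + K‖ : K compact}`. -/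
instance : Norm (Calkin H) := inferInstanceAs (Norm ((H →L[ℂ] H) ⧸ compactIdeal H))

theorem Calkin.norm_mk_le (T : H →L[ℂ] H) : ‖Calkin.mk H T‖ ≤ ‖T‖ :=
  Submodule.Quotient.norm_mk_le (S := compactIdeal H) T

theorem Calkin.norm_mk_lt (x : Calkin H) {ε : ℝ} (hε : 0 < ε) :
    ∃ T : H →L[ℂ] H, Calkin.mk H T = x ∧ ‖T‖ < ‖x‖ + ε :=
  Submodule.Quotient.norm_mk_lt (S := compactIdeal H) x hε

variable [CompleteSpace H]

theorem compactIdeal_isClosed : IsClosed ((compactIdeal H : Ideal (H →L[ℂ] H)) : Set (H →L[ℂ] H)) :=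
  isClosed_setOfPred_isCompactOperator

instance : IsClosed ((compactIdeal H : Ideal (H →L[ℂ] H)) : Set (H →L[ℂ] H)) :=
  compactIdeal_isClosed

instance : MetricSpace (Calkin H) :=
  (Submodule.Quotient.normedAddCommGroup (compactIdeal H)).toMetricSpace

instance : NormedRing (Calkin H) :=
  { (inferInstance : Norm (Calkin H)), (inferInstance : Ring (Calkin H)),
    (inferInstance : MetricSpace (Calkin H)) with
    dist_eq := (Submodule.Quotient.normedAddCommGroup (compactIdeal H)).dist_eq
    norm_mul_le := fun x y => by
      have key : ∀ ε : ℝ, 0 < ε → ‖x * y‖ ≤ (‖x‖ + ε) * (‖y‖ + ε) := by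
        intro ε hε
        obtain ⟨S, hS, hS'⟩ := Calkin.norm_mk_lt x hε
        obtain ⟨T, hT, hT'⟩ := Calkin.norm_mk_lt y hε
        have h : ‖x * y‖ ≤ ‖S * T‖ := by
          rw [← hS, ← hT, ← map_mul]
          exact Calkin.norm_mk_le _
        exact h.trans ((norm_mul_le S T).trans (mul_le_mul hS'.le hT'.le (norm_nonneg T)
          ((norm_nonneg S).trans hS'.le)))
      have hlim : Filter.Tendsto (fun ε : ℝ => (‖x‖ + ε) * (‖y‖ + ε))
          (nhdsWithin 0 (Set.Ioi 0)) (nhds (‖x‖ * ‖y‖)) := by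
        have hc : Continuous fun ε : ℝ => (‖x‖ + ε) * (‖y‖ + ε) := by fun_prop
        have := (hc.tendsto 0).mono_left (nhdsWithin_le_nhds (s := Set.Ioi (0 : ℝ)))
        simpa using this
      exact ge_of_tendsto hlim
        (Filter.eventually_of_mem self_mem_nhdsWithin fun ε hε => key ε hε) }

instance : NormedAlgebra ℂ (Calkin H) :=
  { (inferInstance : Algebra ℂ (Calkin H)) with
    norm_smul_le := fun c x => by
      have key : ∀ ε : ℝ, 0 < ε → ‖c • x‖ ≤ ‖c‖ * (‖x‖ + ε) := by
        intro ε hε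
        obtain ⟨T, hT, hT'⟩ := Calkin.norm_mk_lt x hε
        have h : ‖c • x‖ ≤ ‖c • T‖ := by
          rw [← hT, ← map_smul]
          exact Calkin.norm_mk_le _
        exact h.trans ((norm_smul_le c T).trans (by gcongr))
      have hlim : Filter.Tendsto (fun ε : ℝ => ‖c‖ * (‖x‖ + ε))
          (nhdsWithin 0 (Set.Ioi 0)) (nhds (‖c‖ * ‖x‖)) := by
        have hc : Continuous fun ε : ℝ => ‖c‖ * (‖x‖ + ε) := by fun_prop
        have := (hc.tendsto 0).mono_left (nhdsWithin_le_nhds (s := Set.Ioi (0 : ℝ)))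
        simpa using this
      exact ge_of_tendsto hlim
        (Filter.eventually_of_mem self_mem_nhdsWithin fun ε hε => key ε hε) }

instance : CompleteSpace (Calkin H) :=
  inferInstanceAs (CompleteSpace ((H →L[ℂ] H) ⧸ compactIdeal H))

/-- The adjoint of a compact operator is compact. -/
theorem isCompactOperator_star {T : H →L[ℂ] H} (hT : IsCompactOperator T) :
    IsCompactOperator (star T : H →L[ℂ] H) := by
  have hS : IsCompactOperator (T * star T : H →L[ℂ] H) := IsCompactOperator.comp_clm hT (star T)
  have htb : TotallyBounded ((T * star T) '' Metric.ball (0 : H) 1) :=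
    (((isCompactOperator_iff_isCompact_closure_image_ball
      ((T * star T : H →L[ℂ] H) : H →ₗ[ℂ] H) one_pos).1 hS).totallyBounded).subset subset_closure
  refine (isCompactOperator_iff_isCompact_closure_image_ball
    ((star T : H →L[ℂ] H) : H →ₗ[ℂ] H) one_pos).2 ?_
  refine isCompact_iff_totallyBounded_isComplete.2 ⟨TotallyBounded.closure ?_, isClosed_closure.isComplete⟩
  rw [Metric.totallyBounded_iff]
  intro ε hε
  obtain ⟨t, hts, htf, ht⟩ := Metric.finite_approx_of_totallyBounded htb (ε ^ 2 / 2) (by positivity)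
  obtain ⟨u, hu, huf, ht⟩ := (Set.exists_subset_image_finite_and
    (p := fun s => (T * star T) '' Metric.ball (0 : H) 1 ⊆ ⋃ y ∈ s, Metric.ball y (ε ^ 2 / 2))).1
    ⟨t, hts, htf, ht⟩
  refine ⟨(star T : H →L[ℂ] H) '' u, huf.image _, ?_⟩
  rintro _ ⟨x, hx, rfl⟩
  obtain ⟨_, ⟨y, hy, rfl⟩, hxy⟩ := Set.mem_iUnion₂.1 (ht ⟨x, hx, rfl⟩)
  refine Set.mem_iUnion₂.2 ⟨_, ⟨y, hy, rfl⟩, ?_⟩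
  rw [mem_ball_iff_norm] at hxy ⊢
  have hx1 : ‖x‖ < 1 := by simpa using hx
  have hy1 : ‖y‖ < 1 := by simpa using hu hy
  have h2 : ‖x - y‖ ≤ 2 := (norm_sub_le x y).trans (by linarith)
  have h3 : ‖(star T : H →L[ℂ] H) (x - y)‖ ^ 2 ≤ ‖(T * star T) (x - y)‖ * ‖x - y‖ := by
    have h4 : inner ℂ ((star T : H →L[ℂ] H) (x - y)) ((star T : H →L[ℂ] H) (x - y)) = inner ℂ ((T * star T) (x - y)) (x - y) := by
      conv_lhs => rw [ContinuousLinearMap.star_eq_adjoint, ContinuousLinearMap.adjoint_inner_right]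
      rfl
    have h5 := norm_inner_le_norm (𝕜 := ℂ) ((T * star T) (x - y)) (x - y)
    rw [← h4, inner_self_eq_norm_sq_to_K] at h5
    simpa using h5
  rw [← map_sub] at hxy
  have h6 : ‖(star T : H →L[ℂ] H) (x - y)‖ ^ 2 < ε ^ 2 := by
    nlinarith [norm_nonneg ((T * star T) (x - y)), norm_nonneg (x - y)]
  have h7 : ‖(star T : H →L[ℂ] H) (x - y)‖ < ε := lt_of_pow_lt_pow_left₀ 2 hε.le h6
  simpa [map_sub] using h7

/-- The involution `π(T)* = π(T*)`. -/
instance : Star (Calkin H) where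
  star := Quotient.lift (fun T : H →L[ℂ] H => Calkin.mk H (star T)) fun S T hST => by
    have h : Calkin.mk H S = Calkin.mk H T := Quotient.sound hST
    have h' := isCompactOperator_star (T := S - T) (Calkin.mk_eq_mk_iff.1 h)
    rw [star_sub] at h'
    exact Calkin.mk_eq_mk_iff.2 h'

theorem Calkin.star_mk (T : H →L[ℂ] H) : star (Calkin.mk H T) = Calkin.mk H (star T) := rfl

instance : StarRing (Calkin H) where
  star_involutive x := by
    obtain ⟨T, rfl⟩ := Calkin.mk_surjective x
    simp only [Calkin.star_mk, star_star]
  star_mul x y := by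
    obtain ⟨S, rfl⟩ := Calkin.mk_surjective x
    obtain ⟨T, rfl⟩ := Calkin.mk_surjective y
    simp only [Calkin.star_mk, ← map_mul, star_mul]
  star_add x y := by
    obtain ⟨S, rfl⟩ := Calkin.mk_surjective x
    obtain ⟨T, rfl⟩ := Calkin.mk_surjective y
    simp only [Calkin.star_mk, ← map_add, star_add]

end Calkin

/-! ### Geodesics in the space of projections of a C⋆-algebra -/

section Geodesics

variable {A : Type*} [NormedRing A] [StarRing A] [NormedAlgebra ℂ A]

/-- The horizontal space at the projection `p`: the anti-Hermitian `p`-codiagonal elements. -/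
def IsHorizontal (p z : A) : Prop :=
  star z = -z ∧ p * z * p = 0 ∧ (1 - p) * z * (1 - p) = 0

/-- The geodesics of the space of selfadjoint projections: `δ(t) = e^{tz} p e^{-tz}` with `p` a
projection and `z` horizontal at `p`. -/
def IsGeodesic (δ : ℝ → A) : Prop :=
  ∃ p z : A, IsStarProjection p ∧ IsHorizontal p z ∧
    ∀ t : ℝ, δ t = NormedSpace.exp (t • z) * p * NormedSpace.exp (-(t • z))

/-- `γ` is piecewise continuously differentiable on `[a, b]` (in particular continuous there). -/
def IsPiecewiseC1On (γ : ℝ → A) (a b : ℝ) : Prop :=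
  ∃ (n : ℕ) (τ : ℕ → ℝ), Monotone τ ∧ τ 0 = a ∧ τ n = b ∧
    ∀ i < n, ContDiffOn ℝ 1 γ (Set.Icc (τ i) (τ (i + 1)))

/-- The length `∫ ‖γ'(t)‖ dt` over `[a, b]`. -/
def curveLength (γ : ℝ → A) (a b : ℝ) : ℝ≥0∞ :=
  ∫⁻ t in Set.Icc a b, ‖deriv γ t‖ₑ

/-- `δ` is a geodesic with `δ(0) = p` and `δ(1) = q` which, on `[0, 1]`, is no longer than any
piecewise `C¹` curve of projections from `p` to `q`. -/
structure IsMinimalGeodesicJoining (p q : A) (δ : ℝ → A) : Prop where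
  isGeodesic : IsGeodesic δ
  source : δ 0 = p
  target : δ 1 = q
  minimal : ∀ (γ : ℝ → A) (a b : ℝ), a < b → IsPiecewiseC1On γ a b →
    (∀ t ∈ Set.Icc a b, IsStarProjection (γ t)) → γ a = p → γ b = q →
    curveLength δ 0 1 ≤ curveLength γ a b

end Geodesics

end

/-! ### Orthonormal families and vector states at infinity -/

section HilbertSpace

open Filter Topology

variable {H : Type*} [NormedAddCommGroup H] [InnerProductSpace ℂ H]

/-! Write `A = P - Q`, `B = 1 - P - Q`, so `A² + B² = 1` and `AB = -BA`, and let `E = N(A - 1) =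
R(P) ∩ N(Q)`, `F = N(A + 1) = N(P) ∩ R(Q)`.

Lower bound. Vector states along an orthonormal sequence in `E` have a limit `φ` on the Calkin
algebra, with `φ(p) = 1` and `φ(q) = 0`. Along a curve `γ` of projections, Cauchy–Schwarz bounds the
speed of `arcsin (2φ(γ) - 1)` by `2‖γ'‖`; as this angle runs from `π/2` to `-π/2`, the length is at
least `π/2` (`ofReal_pi_div_two_le_curveLength`).

Upper bound. Let `θ = arcsin A`. A symmetry `R` that anticommutes with `A` and satisfies `R|B| = -B`
gives `Z = -θR`, skew and codiagonal, with `‖Z‖ ≤ π/2` and `e^Z P e^{-Z} = Q`. On `N(B) = E ⊕ F` it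
must exchange `E` and `F`, which is possible because both have countably infinite dimension
(`exists_isRotation`). Hence `π(Z)` generates a minimal geodesic.

Non-uniqueness. The unitary equal to `c` on `F` and to `1` on its orthogonal complement commutes
with `P` and `Q`, so conjugating `Z` by it gives another exponent `Z_c`, equal to `cZ` on `E`
(`exists_isRotation_circle`). If `c` and `d` gave the same geodesic, `Z_c - Z_d` would be compact on
`E`; but it is bounded below there by `‖c - d‖`, and `E` is infinite-dimensional. -/

theorem Orthonormal.one_le_dist {ι : Type*} {v : ι → H} (hv : Orthonormal ℂ v) {i j : ι}
    (hij : i ≠ j) : 1 ≤ dist (v i) (v j) := by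
  have h : ‖v i - v j‖ ^ 2 = 2 := by
    rw [@norm_sub_sq ℂ, hv.1 i, hv.1 j, hv.2 hij]
    norm_num
  rw [dist_eq_norm]
  nlinarith [norm_nonneg (v i - v j)]

theorem Orthonormal.countable [TopologicalSpace.SeparableSpace H] {ι : Type*} {v : ι → H}
    (hv : Orthonormal ℂ v) : Countable ι := by
  refine Pairwise.countable_of_isOpen_disjoint (s := fun i => Metric.ball (v i) (1 / 2))
    (fun i j hij => Metric.ball_disjoint_ball ?_) (fun _ => Metric.isOpen_ball)
    (fun i => ⟨v i, by simp⟩)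
  linarith [hv.one_le_dist hij]

theorem exists_hilbertBasis_nat (E : Type*) [NormedAddCommGroup E] [InnerProductSpace ℂ E]
    [CompleteSpace E] [TopologicalSpace.SeparableSpace E] (hE : ¬ FiniteDimensional ℂ E) :
    Nonempty (HilbertBasis ℕ ℂ E) := by
  obtain ⟨w, b, -⟩ := exists_hilbertBasis ℂ E
  have : Countable w := b.orthonormal.countable
  have hw : Infinite w := by
    by_contra hfin
    rw [not_infinite_iff_finite] at hfin
    have := Fintype.ofFinite w
    exact hE (b.toOrthonormalBasis.toBasis.finiteDimensional_of_finite)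
  obtain ⟨f⟩ : Nonempty (ℕ ≃ w) := by
    have := Encodable.ofCountable w
    have := Denumerable.ofEncodableOfInfinite w
    exact ⟨(Denumerable.eqv w).symm⟩
  refine ⟨HilbertBasis.mk (v := b ∘ f) (b.orthonormal.comp f f.injective) ?_⟩
  rw [f.surjective.range_comp, b.dense_span]

theorem Orthonormal.tendsto_inner_zero {e : ℕ → H} (he : Orthonormal ℂ e) (x : H) :
    Tendsto (fun n => inner ℂ (e n) x) atTop (𝓝 0) := by
  have h := (he.inner_products_summable x).tendsto_atTop_zero
  rw [tendsto_zero_iff_norm_tendsto_zero]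
  have h2 := h.sqrt
  simpa using h2

/-- By compactness the images converge along the ultrafilter to some `y`. Since `⟨T eₙ, y⟩ = ⟨eₙ, T*
y⟩` tends to `0` by Bessel, `⟨y, y⟩ = 0`. -/
theorem Orthonormal.tendsto_compact [CompleteSpace H] {e : ℕ → H} (he : Orthonormal ℂ e)
    {T : H →L[ℂ] H} (hT : IsCompactOperator T) :
    Tendsto (fun n => T (e n)) (hyperfilter ℕ) (𝓝 0) := by
  have hK := (isCompactOperator_iff_isCompact_closure_image_closedBall
    (T : H →ₗ[ℂ] H) one_pos).1 hT
  obtain ⟨y, -, hy⟩ := hK.ultrafilter_le_nhds ((hyperfilter ℕ).map fun n => T (e n)) (by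
    rw [Ultrafilter.coe_map, le_principal_iff, mem_map]
    refine Filter.univ_mem' fun n => subset_closure ⟨e n, ?_, rfl⟩
    simp [he.1 n])
  have hy' : Tendsto (fun n => T (e n)) (hyperfilter ℕ) (𝓝 y) := hy
  have hy0 : y = 0 := by
    have h1 : Tendsto (fun n => inner ℂ (T (e n)) y) (hyperfilter ℕ) (𝓝 (inner ℂ y y)) :=
      hy'.inner tendsto_const_nhds
    have h2 := (he.tendsto_inner_zero ((star T : H →L[ℂ] H) y)).mono_left Nat.hyperfilter_le_atTop
    simp only [ContinuousLinearMap.star_eq_adjoint, ContinuousLinearMap.adjoint_inner_right] at h2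
    exact inner_self_eq_zero.1 (tendsto_nhds_unique h1 h2)
  rwa [hy0] at hy'

variable [CompleteSpace H]

/-- The vector states along an orthonormal sequence have a limit on the Calkin algebra. -/
theorem exists_calkin_state {e : ℕ → H} (he : Orthonormal ℂ e) :
    ∃ φ : Calkin H →L[ℝ] ℝ, ∀ T : H →L[ℂ] H,
      Tendsto (fun n => (inner ℂ (e n) (T (e n))).re) (hyperfilter ℕ) (𝓝 (φ (Calkin.mk H T))) := by
  have hbound : ∀ (T : H →L[ℂ] H) n, |(inner ℂ (e n) (T (e n))).re| ≤ ‖T‖ := fun T n =>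
    calc |(inner ℂ (e n) (T (e n))).re| ≤ ‖inner ℂ (e n) (T (e n))‖ := Complex.abs_re_le_norm _
      _ ≤ ‖e n‖ * ‖T (e n)‖ := norm_inner_le_norm _ _
      _ ≤ ‖T‖ := by simpa [he.1 n] using T.le_opNorm (e n)
  have hlim : ∀ T : H →L[ℂ] H, ∃ c : ℝ,
      Tendsto (fun n => (inner ℂ (e n) (T (e n))).re) (hyperfilter ℕ) (𝓝 c) := fun T => by
    obtain ⟨c, -, hc⟩ := (isCompact_Icc (a := -‖T‖) (b := ‖T‖)).ultrafilter_le_nhds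
      ((hyperfilter ℕ).map fun n => (inner ℂ (e n) (T (e n))).re) (by
        rw [Ultrafilter.coe_map, le_principal_iff, mem_map]
        exact Filter.univ_mem' fun n => abs_le.1 (hbound T n))
    exact ⟨c, hc⟩
  -- Two lifts of `x` differ by a compact operator, which tends to `0` along `e`, so the limit
  -- depends on `x` alone.
  have hlim' : ∀ x : Calkin H, ∃ c : ℝ, ∀ T : H →L[ℂ] H, Calkin.mk H T = x →
      Tendsto (fun n => (inner ℂ (e n) (T (e n))).re) (hyperfilter ℕ) (𝓝 c) := fun x => by
    obtain ⟨S, rfl⟩ := Calkin.mk_surjective x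
    obtain ⟨c, hc⟩ := hlim S
    refine ⟨c, fun T hTS => ?_⟩
    have h0 := (he.tendsto_compact (Calkin.mk_eq_mk_iff.1 hTS)).norm
    have h1 : Tendsto (fun n => (inner ℂ (e n) ((T - S) (e n))).re) (hyperfilter ℕ) (𝓝 0) := by
      refine squeeze_zero_norm (fun n => ?_) (by simpa using h0)
      refine (Complex.abs_re_le_norm _).trans ((norm_inner_le_norm _ _).trans ?_)
      simp [he.1 n]
    have h2 := hc.add h1
    simpa [inner_sub_right] using h2
  choose φ hφ using hlim'
  have key : ∀ T : H →L[ℂ] H, Tendsto (fun n => (inner ℂ (e n) (T (e n))).re) (hyperfilter ℕ)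
      (𝓝 (φ (Calkin.mk H T))) := fun T => hφ _ T rfl
  let φl : Calkin H →ₗ[ℝ] ℝ :=
    { toFun := φ
      map_add' := fun x y => by
        obtain ⟨S, rfl⟩ := Calkin.mk_surjective x
        obtain ⟨T, rfl⟩ := Calkin.mk_surjective y
        have h := (key S).add (key T)
        refine tendsto_nhds_unique (hφ _ (S + T) (map_add _ _ _)) ?_
        simpa [inner_add_right] using h
      map_smul' := fun r x => by
        obtain ⟨S, rfl⟩ := Calkin.mk_surjective x
        have h := (key S).const_mul r
        have hr : r • Calkin.mk H S = (r : ℂ) • Calkin.mk H S := rfl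
        refine tendsto_nhds_unique (hφ _ ((r : ℂ) • S) ((map_smul _ _ _).trans hr.symm)) ?_
        simpa [inner_smul_right] using h }
  refine ⟨φl.mkContinuous 1 fun x => ?_, key⟩
  rw [one_mul]
  refine le_of_forall_pos_le_add fun ε hε => ?_
  obtain ⟨T, rfl, hT⟩ := Calkin.norm_mk_lt x hε
  exact (le_of_tendsto (key T).norm (Eventually.of_forall fun n => hbound T n)).trans hT.le

/-- The Cauchy–Schwarz inequality for a limit of vector states, at two projections. -/
theorem calkin_state_mul_mul_le {e : ℕ → H} {φ : Calkin H →L[ℝ] ℝ}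
    (hφ : ∀ T : H →L[ℂ] H,
      Tendsto (fun n => (inner ℂ (e n) (T (e n))).re) (hyperfilter ℕ) (𝓝 (φ (Calkin.mk H T))))
    {x z : Calkin H} (hx : IsStarProjection x) (hz : IsStarProjection z) (y : Calkin H) :
    |φ (x * y * z)| ≤ √(φ x) * ‖y‖ * √(φ z) := by
  -- A lift `W` of a projection `w` need not be a projection, but `star W * W` is again a lift of
  -- `w`, so `φ w` is the limit of `‖W (e n)‖²`.
  have hsq : ∀ w : Calkin H, IsStarProjection w → ∀ W : H →L[ℂ] H, Calkin.mk H W = w →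
      Tendsto (fun n => ‖W (e n)‖) (hyperfilter ℕ) (𝓝 √(φ w)) := by
    rintro w hw W rfl
    have h1 : Calkin.mk H (star W * W) = Calkin.mk H W := by
      rw [map_mul, ← Calkin.star_mk, hw.isSelfAdjoint.star_eq, hw.isIdempotentElem.eq]
    have h := (hφ (star W * W)).sqrt
    rw [h1] at h
    refine h.congr fun n => ?_
    rw [mul_apply_eq_comp, ContinuousLinearMap.star_eq_adjoint,
      ContinuousLinearMap.adjoint_inner_right, inner_self_eq_norm_sq_to_K]
    norm_cast
    exact Real.sqrt_sq (norm_nonneg _)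
  obtain ⟨X, hX⟩ := Calkin.mk_surjective x
  obtain ⟨Z, hZ⟩ := Calkin.mk_surjective z
  have key : ∀ ε : ℝ, 0 < ε → |φ (x * y * z)| ≤ √(φ x) * (‖y‖ + ε) * √(φ z) := by
    intro ε hε
    obtain ⟨Y, hY, hY'⟩ := Calkin.norm_mk_lt y hε
    have h1 := (hφ (star X * Y * Z)).abs
    rw [map_mul (Calkin.mk H), map_mul (Calkin.mk H), ← Calkin.star_mk, hX, hY, hZ, hx.isSelfAdjoint.star_eq] at h1
    refine le_of_tendsto_of_tendsto h1
      (((hsq x hx X hX).mul tendsto_const_nhds).mul (hsq z hz Z hZ))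
      (Eventually.of_forall fun n => ?_)
    calc |(inner ℂ (e n) ((star X * Y * Z) (e n))).re|
        ≤ ‖inner ℂ (e n) ((star X * Y * Z) (e n))‖ := Complex.abs_re_le_norm _
      _ = ‖inner ℂ (X (e n)) (Y (Z (e n)))‖ := by
        rw [mul_assoc, mul_apply_eq_comp, ContinuousLinearMap.star_eq_adjoint,
          ContinuousLinearMap.adjoint_inner_right]
        rfl
      _ ≤ ‖X (e n)‖ * ‖Y (Z (e n))‖ := norm_inner_le_norm _ _
      _ ≤ ‖X (e n)‖ * ((‖y‖ + ε) * ‖Z (e n)‖) := by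
        gcongr
        exact Y.le_of_opNorm_le hY'.le _
      _ = ‖X (e n)‖ * (‖y‖ + ε) * ‖Z (e n)‖ := by ring
  have hc : Continuous fun ε : ℝ => √(φ x) * (‖y‖ + ε) * √(φ z) := by fun_prop
  have := (hc.tendsto 0).mono_left (nhdsWithin_le_nhds (s := Set.Ioi (0 : ℝ)))
  rw [add_zero] at this
  exact ge_of_tendsto this (Filter.eventually_of_mem self_mem_nhdsWithin fun ε hε => key ε hε)

end HilbertSpace

/-! ### A lower bound for the length of curves of projections -/

section LowerBound

open Filter Topology Real

variable {A : Type*} [NormedRing A] [NormedAlgebra ℂ A]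

/-- Chain rule estimate for `arcsin (r * g)`. The factor `r < 1` keeps the argument away from `±1`,
where `arcsin` is not differentiable, and costs nothing since `r √(1 - g²) ≤ √(1 - (r g)²)`. -/
theorem abs_arcsin_deriv_le {r g g' c : ℝ} (hr0 : 0 ≤ r) (hr1 : r < 1) (hg : |g| ≤ 1)
    (hc : 0 ≤ c) (h : |g'| ≤ c * √(1 - g ^ 2)) :
    |1 / √(1 - (r * g) ^ 2) * (r * g')| ≤ c := by
  have hg2 : g ^ 2 ≤ 1 := (sq_le_one_iff_abs_le_one g).2 hg
  have hpos : 0 < 1 - (r * g) ^ 2 := by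
    have hr2 : r ^ 2 < 1 := by nlinarith
    have := mul_le_of_le_one_right (sq_nonneg r) hg2
    rw [mul_pow]
    linarith
  have hs := Real.sqrt_pos.2 hpos
  rw [abs_mul, abs_of_pos (one_div_pos.2 hs), one_div, inv_mul_le_iff₀ hs, abs_mul,
    abs_of_nonneg hr0, mul_comm _ c]
  have h1 : r * √(1 - g ^ 2) ≤ √(1 - (r * g) ^ 2) := by
    refine Real.le_sqrt_of_sq_le ?_
    rw [mul_pow, Real.sq_sqrt (by linarith)]
    nlinarith
  calc r * |g'| ≤ r * (c * √(1 - g ^ 2)) := by gcongr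
    _ = c * (r * √(1 - g ^ 2)) := by ring
    _ ≤ c * √(1 - (r * g) ^ 2) := by gcongr

/-- The derivative of a curve of projections is co-diagonal. -/
theorem deriv_eq_codiagonal {γ : ℝ → A} {t : ℝ} {γ' : A} (hγ : HasDerivAt γ γ' t)
    (hproj : ∀ᶠ s in 𝓝 t, IsIdempotentElem (γ s)) :
    γ' = γ t * γ' * (1 - γ t) + (1 - γ t) * γ' * γ t := by
  have h1 : HasDerivAt (fun s => γ s * γ s) γ' t :=
    hγ.congr_of_eventuallyEq (hproj.mono fun s hs => hs.eq)
  have h2 := h1.unique (hγ.mul hγ)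
  have hi : γ t * γ t = γ t := hproj.self_of_nhds
  -- Differentiating `γ² = γ` gives `γ' = γ'γ + γγ'`; multiplying by `γ` on the left kills the
  -- diagonal corner.
  have h3 : γ t * γ' * γ t = 0 := by
    have h4 : γ t * γ' = γ t * (γ' * γ t + γ t * γ') := by rw [← h2]
    rw [mul_add, ← mul_assoc, ← mul_assoc, hi] at h4
    simpa using h4
  calc γ' = γ t * γ' + γ' * γ t - 2 • (γ t * γ' * γ t) := by
        rw [h3, smul_zero, sub_zero, add_comm]; exact h2
    _ = _ := by noncomm_ring

variable [StarRing A]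

/-- Put `g = φ ∘ γ`, with values in `[0, 1]`. As `γ'` is codiagonal, the Cauchy–Schwarz hypothesis
yields `|g'| ≤ 2‖γ'‖ √(g (1 - g))`, so `arcsin (2g - 1)` moves with speed at most `2‖γ'‖` and has to
cover a distance `π`. -/
theorem ofReal_pi_div_two_le_curveLength {φ : A →L[ℝ] ℝ} (hφ1 : φ 1 = 1)
    (hφ0 : ∀ x : A, IsStarProjection x → 0 ≤ φ x)
    (hφ : ∀ x z : A, IsStarProjection x → IsStarProjection z → ∀ y : A,
      |φ (x * y * z)| ≤ √(φ x) * ‖y‖ * √(φ z))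
    {γ : ℝ → A} {a b : ℝ} (hγ : IsPiecewiseC1On γ a b)
    (hproj : ∀ t ∈ Set.Icc a b, IsStarProjection (γ t)) (ha : φ (γ a) = 1) (hb : φ (γ b) = 0) :
    ENNReal.ofReal (π / 2) ≤ curveLength γ a b := by
  obtain ⟨n, τ, hτ, rfl, rfl, hC1⟩ := hγ
  have hmem : ∀ t ∈ Set.Icc (τ 0) (τ n), |2 * φ (γ t) - 1| ≤ 1 := fun t ht => by
    have h0 := hφ0 _ (hproj t ht)
    have h1 := hφ0 _ (hproj t ht).one_sub
    rw [map_sub, hφ1] at h1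
    rw [abs_le]; constructor <;> linarith
  -- Induction over the pieces of the subdivision; `r < 1` makes the composite with `arcsin` of
  -- class `C¹` up to the ends of each piece.
  have key : ∀ r : ℝ, 0 ≤ r → r < 1 → ∀ i ≤ n,
      ‖arcsin (r * (2 * φ (γ (τ i)) - 1)) - arcsin (r * (2 * φ (γ (τ 0)) - 1))‖ₑ
        ≤ 2 * curveLength γ (τ 0) (τ i) := by
    intro r hr0 hr1 i
    have hlt : ∀ t ∈ Set.Icc (τ 0) (τ n), |r * (2 * φ (γ t) - 1)| < 1 := fun t ht => by
      rw [abs_mul, abs_of_nonneg hr0]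
      exact (mul_le_of_le_one_right hr0 (hmem t ht)).trans_lt hr1
    induction i with
    | zero => simp
    | succ i ih =>
      intro hi
      have hle : τ i ≤ τ (i + 1) := hτ i.le_succ
      have hsub : Set.Icc (τ i) (τ (i + 1)) ⊆ Set.Icc (τ 0) (τ n) :=
        Set.Icc_subset_Icc (hτ (Nat.zero_le _)) (hτ hi)
      have hpiece : ‖arcsin (r * (2 * φ (γ (τ (i + 1))) - 1))
          - arcsin (r * (2 * φ (γ (τ i)) - 1))‖ₑ
          ≤ 2 * ∫⁻ t in Set.Icc (τ i) (τ (i + 1)), ‖deriv γ t‖ₑ := by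
        have hγi := hC1 i hi
        have hg : ContDiffOn ℝ 1 (fun t => r * (2 * φ (γ t) - 1))
            (Set.Icc (τ i) (τ (i + 1))) :=
          contDiffOn_const.mul ((contDiffOn_const.mul
            (φ.contDiff.comp_contDiffOn hγi)).sub contDiffOn_const)
        have hC : ContDiffOn ℝ 1 (fun t => arcsin (r * (2 * φ (γ t) - 1)))
            (Set.Icc (τ i) (τ (i + 1))) := fun t ht => by
          have h := abs_lt.1 (hlt t (hsub ht))
          exact ContDiffAt.comp_contDiffWithinAt (g := arcsin) t
            (contDiffAt_arcsin h.1.ne' h.2.ne) (hg t ht)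
        refine (enorm_sub_le_lintegral_deriv_of_contDiffOn_Icc hC hle).trans ?_
        rw [← MeasureTheory.lintegral_const_mul' _ _ (by norm_num)]
        refine MeasureTheory.lintegral_mono_ae ?_
        -- The breakpoints, where `γ` may fail to have a two-sided derivative, form a null set.
        rw [← MeasureTheory.restrict_Ioo_eq_restrict_Icc]
        filter_upwards [MeasureTheory.self_mem_ae_restrict measurableSet_Ioo] with t ht
        have hnhds : Set.Icc (τ i) (τ (i + 1)) ∈ 𝓝 t := Icc_mem_nhds ht.1 ht.2
        have htI := hsub ⟨ht.1.le, ht.2.le⟩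
        have hd : HasDerivAt γ (deriv γ t) t :=
          (((hγi t ⟨ht.1.le, ht.2.le⟩).contDiffAt hnhds).differentiableAt one_ne_zero).hasDerivAt
        have hcod := deriv_eq_codiagonal hd (by
          filter_upwards [hnhds] with s hs using (hproj s (hsub hs)).isIdempotentElem)
        have hp := hproj t htI
        have hdφ : |φ (deriv γ t)| ≤ 2 * (√(φ (γ t)) * ‖deriv γ t‖ * √(φ (1 - γ t))) := by
          conv_lhs => rw [hcod, map_add]
          refine (abs_add_le _ _).trans ?_
          have h1 := hφ _ _ hp hp.one_sub (deriv γ t)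
          have h2 := hφ _ _ hp.one_sub hp (deriv γ t)
          linarith
        have hdg : HasDerivAt (fun s => arcsin (r * (2 * φ (γ s) - 1)))
            (1 / √(1 - (r * (2 * φ (γ t) - 1)) ^ 2) * (r * (2 * φ (deriv γ t)))) t := by
          have h := abs_lt.1 (hlt t htI)
          exact (hasDerivAt_arcsin h.1.ne' h.2.ne).comp t
            ((((φ.hasFDerivAt.comp_hasDerivAt t hd).const_mul 2).sub_const 1).const_mul r)
        rw [hdg.deriv]
        have hfin : |1 / √(1 - (r * (2 * φ (γ t) - 1)) ^ 2) * (r * (2 * φ (deriv γ t)))|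
            ≤ 2 * ‖deriv γ t‖ := by
          refine abs_arcsin_deriv_le hr0 hr1 (hmem t htI) (by positivity) ?_
          have h0 := hφ0 _ hp
          have h1 := hφ0 _ hp.one_sub
          have h2 : √(1 - (2 * φ (γ t) - 1) ^ 2) = 2 * (√(φ (γ t)) * √(φ (1 - γ t))) := by
            have h3 : 1 - (2 * φ (γ t) - 1) ^ 2 = 2 ^ 2 * (φ (γ t) * φ (1 - γ t)) := by
              rw [map_sub, hφ1]; ring
            rw [h3, Real.sqrt_mul (by norm_num), Real.sqrt_sq (by norm_num), Real.sqrt_mul h0]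
          rw [h2, abs_mul, abs_two]
          linarith
        rw [← Real.norm_eq_abs] at hfin
        have h4 := ENNReal.ofReal_le_ofReal hfin
        rwa [ofReal_norm, ENNReal.ofReal_mul (by norm_num), ofReal_norm,
          ENNReal.ofReal_ofNat] at h4
      have hsplit : curveLength γ (τ 0) (τ (i + 1)) = curveLength γ (τ 0) (τ i)
          + ∫⁻ t in Set.Icc (τ i) (τ (i + 1)), ‖deriv γ t‖ₑ := by
        rw [curveLength, curveLength, ← MeasureTheory.restrict_Ioc_eq_restrict_Icc
          (a := τ i), ← MeasureTheory.lintegral_union measurableSet_Ioc,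
          Set.Icc_union_Ioc_eq_Icc (hτ (Nat.zero_le _)) hle]
        exact Set.disjoint_left.2 fun x hx hx' => not_lt.2 hx.2 hx'.1
      rw [hsplit, mul_add]
      calc _ = ‖(arcsin (r * (2 * φ (γ (τ i)) - 1)) - arcsin (r * (2 * φ (γ (τ 0)) - 1)))
            + (arcsin (r * (2 * φ (γ (τ (i + 1))) - 1))
              - arcsin (r * (2 * φ (γ (τ i)) - 1)))‖ₑ := by congr 1; ring
        _ ≤ _ := (enorm_add_le _ _).trans (add_le_add (ih (Nat.le_of_succ_le hi)) hpiece)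
  have key2 : ∀ r : ℝ, 0 ≤ r → r < 1 →
      ENNReal.ofReal (2 * arcsin r) ≤ 2 * curveLength γ (τ 0) (τ n) := fun r hr0 hr1 => by
    have h := key r hr0 hr1 n le_rfl
    rw [ha, hb] at h
    refine le_trans (le_of_eq ?_) h
    rw [← ofReal_norm]
    congr 1
    rw [Real.norm_eq_abs, show r * (2 * 0 - 1) = -r by ring, show r * (2 * 1 - 1) = r by ring,
      arcsin_neg, abs_sub_comm, sub_neg_eq_add, ← two_mul,
      abs_of_nonneg (mul_nonneg zero_le_two (arcsin_nonneg.2 hr0))]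
  have hlim : Tendsto (fun r : ℝ => ENNReal.ofReal (2 * arcsin r)) (𝓝[<] 1)
      (𝓝 (ENNReal.ofReal (2 * arcsin 1))) := by
    refine ENNReal.tendsto_ofReal (Tendsto.const_mul 2 ?_)
    exact (continuous_arcsin.tendsto 1).mono_left nhdsWithin_le_nhds
  have h1 := le_of_tendsto hlim (by
    filter_upwards [Ioo_mem_nhdsLT (zero_lt_one' ℝ)] with r hr using key2 r hr.1.le hr.2)
  rw [arcsin_one, ENNReal.ofReal_mul zero_le_two, ENNReal.ofReal_ofNat] at h1
  exact (ENNReal.mul_le_mul_iff_right (by norm_num) (by norm_num)).1 h1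

end LowerBound

/-! ### Operators exchanging subspaces and polar decompositions -/

section Operators

variable {H : Type*} [NormedAddCommGroup H] [InnerProductSpace ℂ H] [CompleteSpace H]

/-- Two orthogonal infinite-dimensional closed subspaces of a separable Hilbert space are
exchanged by an operator that is isometric and involutive on their sum. -/
theorem exists_isometric_swap [TopologicalSpace.SeparableSpace H] {E F : Submodule ℂ H}
    (hEc : IsClosed (E : Set H)) (hFc : IsClosed (F : Set H)) (hEF : E ⟂ F)
    (hE : ¬ FiniteDimensional ℂ E) (hF : ¬ FiniteDimensional ℂ F) :
    ∃ V : H →L[ℂ] H, ∀ x ∈ E, ∀ y ∈ F, V x ∈ F ∧ V y ∈ E ∧ V (V x) = x ∧ V (V y) = y ∧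
      ‖V (x + y)‖ = ‖x + y‖ := by
  have : CompleteSpace E := hEc.completeSpace_coe
  have : CompleteSpace F := hFc.completeSpace_coe
  have : SecondCountableTopology H := UniformSpace.secondCountable_of_separable H
  obtain ⟨b⟩ := exists_hilbertBasis_nat E hE
  obtain ⟨c⟩ := exists_hilbertBasis_nat F hF
  -- Separability makes both Hilbert dimensions `ℵ₀`, so the two bases can be matched.
  let U : E ≃ₗᵢ[ℂ] F := b.repr.trans c.repr.symm
  let V : H →L[ℂ] H :=
    F.subtypeL ∘L (U.toContinuousLinearEquiv : E →L[ℂ] F) ∘L E.orthogonalProjectionOnto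
      + E.subtypeL ∘L (U.symm.toContinuousLinearEquiv : F →L[ℂ] E) ∘L F.orthogonalProjectionOnto
  have hVE : ∀ x : E, V x = U x := fun x => by
    have h : F.orthogonalProjectionOnto (x : H) = 0 :=
      Submodule.orthogonalProjectionOnto_apply_of_mem_orthogonal
        (hEF x.2)
    simp [V, h]
  have hVF : ∀ y : F, V y = U.symm y := fun y => by
    have h : E.orthogonalProjectionOnto (y : H) = 0 :=
      Submodule.orthogonalProjectionOnto_apply_of_mem_orthogonal
        (hEF.symm y.2)
    simp [V, h]
  refine ⟨V, fun x hx y hy => ?_⟩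
  lift x to E using hx
  lift y to F using hy
  refine ⟨by simp [hVE], by simp [hVF], by simp [hVE, hVF], by simp [hVE, hVF], ?_⟩
  have h1 : inner ℂ (x : H) (y : H) = 0 := hEF.inner_eq x.2 y.2
  have h2 : inner ℂ (U x : H) (U.symm y : H) = 0 := hEF.symm.inner_eq (U x).2 (U.symm y).2
  have h3 := norm_add_sq_eq_norm_sq_add_norm_sq_of_inner_eq_zero (x : H) (y : H) h1
  have h4 := norm_add_sq_eq_norm_sq_add_norm_sq_of_inner_eq_zero _ _ h2
  rw [map_add, hVE, hVF]
  rw [← Submodule.coe_norm, ← Submodule.coe_norm, U.norm_map, U.symm.norm_map] at h4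
  exact (mul_self_inj (norm_nonneg _) (norm_nonneg _)).1 (h4.trans h3.symm)

theorem IsSelfAdjoint.norm_apply_sq {B : H →L[ℂ] H} (hB : IsSelfAdjoint B) (x : H) :
    ((‖B x‖ : ℂ)) ^ 2 = inner ℂ ((B * B) x) x := by
  have h : inner ℂ (B x) (B x) = inner ℂ ((B * B) x) x := by
    conv_lhs => rw [← ContinuousLinearMap.adjoint_inner_left, hB.adjoint_eq]
    rfl
  rw [← h, inner_self_eq_norm_sq_to_K]
  rfl

/-- The selfadjoint unitary completing the polar decomposition of `-B`: it sends `M x` to `-B x`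
where `M * M = B * B`, and is prescribed on the kernel of `B`. -/
theorem exists_symmetry {A B M V : H →L[ℂ] H} (hB : IsSelfAdjoint B) (hM : IsSelfAdjoint M)
    (hMB : M * M = B * B) (hcomm : M * B = B * M) (hMA : M * A = A * M) (hAB : A * B = -(B * A))
    (hV : ∀ k, B k = 0 → B (V k) = 0 ∧ V (V k) = k ∧ V (A k) = -A (V k) ∧ ‖V k‖ = ‖k‖) :
    ∃ R : H →L[ℂ] H, IsSelfAdjoint R ∧ R * R = 1 ∧ R * A = -(A * R) ∧ R * M = -B ∧ M * R = -B ∧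
      ∀ k, B k = 0 → R k = V k := by
  have hnorm : ∀ x, ‖M x‖ = ‖B x‖ := fun x => by
    have h := hM.norm_apply_sq x
    rw [hMB, ← hB.norm_apply_sq x] at h
    exact (sq_eq_sq₀ (norm_nonneg _) (norm_nonneg _)).1 (by exact_mod_cast h)
  have hker : ∀ k, B k = 0 → M k = 0 := fun k hk => by
    rw [← norm_eq_zero, hnorm, hk, norm_zero]
  let K : Submodule ℂ H := LinearMap.ker (B : H →ₗ[ℂ] H)
  have hK : ∀ k : K, B k = 0 := fun k => LinearMap.mem_ker.1 k.2
  -- `R` is to send `M x + k` to `-B x + V k`. Both sums are orthogonal and `‖M x‖ = ‖B x‖`, so `f`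
  -- factors isometrically through `e`.
  let e : H × K →ₗ[ℂ] H := (M : H →ₗ[ℂ] H).coprod K.subtype
  let f : H × K →ₗ[ℂ] H := (-B : H →ₗ[ℂ] H).coprod ((V : H →ₗ[ℂ] H) ∘ₗ K.subtype)
  have horth : ∀ C : H →L[ℂ] H, IsSelfAdjoint C → ∀ x k, C k = 0 → inner ℂ (C x) k = 0 :=
    fun C hC x k hk => by
      rw [← ContinuousLinearMap.adjoint_inner_right, hC.adjoint_eq, hk, inner_zero_right]
  have hfe : ∀ w, ‖f w‖ = ‖e w‖ := by
    rintro ⟨x, k⟩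
    have h1 := norm_add_sq_eq_norm_sq_add_norm_sq_of_inner_eq_zero (M x) (k : H)
      (horth M hM x k (hker k (hK k)))
    have h2 := norm_add_sq_eq_norm_sq_add_norm_sq_of_inner_eq_zero (𝕜 := ℂ) (-B x) (V k)
      (by rw [inner_neg_left, horth B hB x _ (hV k (hK k)).1, neg_zero])
    rw [norm_neg, (hV k (hK k)).2.2.2, ← hnorm x] at h2
    refine (mul_self_inj (norm_nonneg _) (norm_nonneg _)).1 (Eq.trans ?_ (h2.trans h1.symm))
    simp [f]
  -- A vector orthogonal to the range of `M` lies in `N(M) = N(B)`, hence is orthogonal to itself.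
  -- Identities between operators can therefore be checked on the range of `M` and on `N(B)`.
  have hdense : DenseRange e := by
    change Dense ((LinearMap.range e : Submodule ℂ H) : Set H)
    rw [Submodule.dense_iff_topologicalClosure_eq_top, Submodule.topologicalClosure_eq_top_iff,
      Submodule.eq_bot_iff]
    intro y hy
    rw [Submodule.mem_orthogonal] at hy
    have hMy : M y = 0 := by
      have h := hy (M (M y)) ⟨(M y, 0), by simp [e]⟩
      rw [← ContinuousLinearMap.adjoint_inner_right, hM.adjoint_eq] at h
      exact inner_self_eq_zero.1 h
    have hBy : B y = 0 := by rw [← norm_eq_zero, ← hnorm, hMy, norm_zero]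
    exact inner_self_eq_zero.1 (hy y ⟨(0, ⟨y, hBy⟩), by simp [e]⟩)
  have hext : ∀ S T : H →L[ℂ] H, S * M = T * M → (∀ k, B k = 0 → S k = T k) → S = T :=
    fun S T h1 h2 => by
      refine ContinuousLinearMap.ext fun x => hdense.induction_on
        (p := fun x => S x = T x) x (isClosed_eq S.continuous T.continuous) ?_
      rintro ⟨x, k⟩
      have h3 : S (M x) = T (M x) := DFunLike.congr_fun h1 x
      simp [e, h3, h2 k (hK k)]
  let R : H →L[ℂ] H := f.extendOfNorm e
  have hR : ∀ w, R (e w) = f w :=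
    LinearMap.extendOfNorm_eq hdense ⟨1, fun w => by rw [one_mul, hfe]⟩
  have hR1 : ∀ x, ‖R x‖ ≤ ‖x‖ := fun x => by
    simpa using LinearMap.norm_extendOfNorm_apply_le hdense 1
      (fun w => by rw [one_mul, hfe]) x
  have hRM : R * M = -B := by
    ext x
    simpa [e, f] using hR (x, 0)
  have hRV : ∀ k, B k = 0 → R k = V k := fun k hk => by
    simpa [e, f] using hR (0, ⟨k, hk⟩)
  have hRB : R * B = -M := by
    refine hext _ _ ?_ fun k hk => by simp [hk, hker k hk]
    rw [mul_assoc, ← hcomm, ← mul_assoc, hRM, neg_mul, neg_mul, hMB]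
  have hRR : R * R = 1 := by
    refine hext _ _ ?_ fun k hk => ?_
    · rw [mul_assoc, hRM, mul_neg, hRB, neg_neg, one_mul]
    · rw [mul_apply_eq_comp, hRV k hk, hRV _ (hV k hk).1, (hV k hk).2.1]
      rfl
  -- An isometric involution is selfadjoint: `R* = R* (R R) = (R* R) R = R`.
  have hRsa : IsSelfAdjoint R := by
    have h1 : ∀ x, ‖R x‖ = ‖x‖ := fun x => by
      refine le_antisymm (hR1 x) ?_
      have h2 : R (R x) = x := DFunLike.congr_fun hRR x
      simpa [h2] using hR1 (R x)
    have h3 : star R * R = 1 := (ContinuousLinearMap.norm_map_iff_adjoint_comp_self R).1 h1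
    calc star R = star R * (R * R) := by rw [hRR, mul_one]
      _ = R := by rw [← mul_assoc, h3, one_mul]
  refine ⟨R, hRsa, hRR, ?_, hRM, ?_, hRV⟩
  · refine hext _ _ ?_ fun k hk => ?_
    · rw [mul_assoc, ← hMA, ← mul_assoc, hRM, neg_mul, neg_mul, mul_assoc, hRM, mul_neg, hAB,
        neg_neg]
    · have hAk : B (A k) = 0 := by
        have h : A (B k) = -(B (A k)) := DFunLike.congr_fun hAB k
        rw [hk, map_zero] at h
        exact neg_eq_zero.1 h.symm
      rw [mul_apply_eq_comp, hRV _ hAk, (hV k hk).2.2.1, ← hRV k hk]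
      rfl
  · have h := congrArg star hRM
    rwa [star_mul, star_neg, hM.star_eq, hB.star_eq, hRsa.star_eq] at h

end Operators

/-! ### The arcsine of a selfadjoint contraction -/

section Arcsin

open Real

variable {A : Type*} [CStarAlgebra A]

/-- Conjugation by the symmetry `r` is a star automorphism taking `a` to `-a`; it commutes with the
functional calculus, and `f(-a) = -f(a)`. -/
theorem cfc_semiconj_of_odd {a r : A} (ha : IsSelfAdjoint a) (hr : IsSelfAdjoint r)
    (hrr : r * r = 1) (hra : r * a = -(a * r)) {f : ℝ → ℝ} (hf : Continuous f)
    (hodd : ∀ x, f (-x) = -f x) : r * cfc f a = -(cfc f a * r) := by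
  let u : unitary A := ⟨r, Unitary.mem_iff.2 ⟨by rw [hr.star_eq, hrr], by rw [hr.star_eq, hrr]⟩⟩
  have h1 : ∀ x, Unitary.conjStarAlgAut ℝ A u x = r * x * r := fun x => by
    rw [Unitary.conjStarAlgAut_apply, show (star u : A) = r from hr.star_eq]
  have h2 : r * a * r = -a := by rw [hra, neg_mul, mul_assoc, hrr, mul_one]
  have h3 := StarAlgHomClass.map_cfc (Unitary.conjStarAlgAut ℝ A u) f a hf.continuousOn
    (by
      have : (fun x => Unitary.conjStarAlgAut ℝ A u x) = fun x => r * x * r := funext h1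
      change Continuous fun x => Unitary.conjStarAlgAut ℝ A u x
      rw [this]; fun_prop) ha (by rw [h1, h2]; exact ha.neg)
  rw [h1, h1, h2, ← cfc_comp_neg f a hf.continuousOn ha] at h3
  simp only [hodd] at h3
  rw [cfc_neg] at h3
  calc r * cfc f a = r * cfc f a * r * r := by rw [mul_assoc _ r r, hrr, mul_one]
    _ = _ := by rw [h3, neg_mul]

/-- `exp (i arcsin a) = √(1 - a²) + i a`. -/
theorem exp_I_smul_cfc_arcsin {a : A} (ha : IsSelfAdjoint a) (ha1 : ‖a‖ ≤ 1) :
    NormedSpace.exp (Complex.I • cfc arcsin a)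
      = cfc (fun x : ℝ => √(1 - x ^ 2)) a + Complex.I • a := by
  obtain (_ | _) := subsingleton_or_nontrivial A
  · exact Subsingleton.elim _ _
  have harc : Continuous fun x : ℂ => ((arcsin x.re : ℝ) : ℂ) :=
    Complex.continuous_ofReal.comp (continuous_arcsin.comp Complex.continuous_re)
  have hIarc : Continuous fun x : ℂ => Complex.I * ((arcsin x.re : ℝ) : ℂ) := by fun_prop
  have hIre : Continuous fun x : ℂ => Complex.I * ((x.re : ℝ) : ℂ) := by fun_prop
  have hsq : Continuous fun x : ℂ => ((√(1 - x.re ^ 2) : ℝ) : ℂ) := by fun_prop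
  have hre : Continuous fun x : ℂ => ((x.re : ℝ) : ℂ) := by fun_prop
  -- The exponent `i arcsin a` is not selfadjoint, so the real calculus is rewritten as the complex
  -- one, with functions read through `re`.
  rw [cfc_real_eq_complex arcsin ha, cfc_real_eq_complex (fun x => √(1 - x ^ 2)) ha,
    ← cfc_const_mul Complex.I _ a harc.continuousOn,
    ← CFC.exp_eq_normedSpace_exp (𝕜 := ℂ) (cfc_predicate _ _),
    ← cfc_comp' _ _ a NormedSpace.exp_continuous.continuousOn
      hIarc.continuousOn ha.isStarNormal]
  have hIa : Complex.I • a = cfc (fun x : ℂ => Complex.I * ((x.re : ℝ) : ℂ)) a := by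
    rw [cfc_const_mul Complex.I _ a hre.continuousOn, ← cfc_real_eq_complex (fun x => x) ha,
      cfc_id' ℝ a]
  rw [hIa, ← cfc_add _ _ _ hsq.continuousOn hIre.continuousOn]
  refine cfc_congr fun x hx => ?_
  have hx1 := abs_le.1 ((Complex.abs_re_le_norm x).trans
    ((spectrum.norm_le_norm_of_mem hx).trans ha1))
  rw [← Complex.exp_eq_exp_ℂ, mul_comm, Complex.exp_mul_I, ← Complex.ofReal_cos,
    ← Complex.ofReal_sin, cos_arcsin, sin_arcsin hx1.1 hx1.2, mul_comm]

/-- Here `θ = arcsin a`, `m = √(1 - a²)` and `s = sinc θ`. The contraction `s` with `s θ = a` serves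
to bound `θ` from below by `a`. That `m` commutes with whatever commutes with `a²` matters because
`1 - P - Q` only anticommutes with `a = P - Q`. -/
theorem exists_arcsin {a : A} (ha : IsSelfAdjoint a) (ha1 : ‖a‖ ≤ 1) :
    ∃ θ m s : A, IsSelfAdjoint θ ∧ IsSelfAdjoint m ∧ ‖θ‖ ≤ π / 2 ∧ ‖s‖ ≤ 1 ∧ s * θ = a ∧
      NormedSpace.exp (Complex.I • θ) = m + Complex.I • a ∧ m * m = 1 - a * a ∧
      Commute a θ ∧ (∀ x, Commute (a * a) x → Commute m x) ∧
      ∀ r : A, IsSelfAdjoint r → r * r = 1 → r * a = -(a * r) → r * θ = -(θ * r) := by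
  obtain (_ | _) := subsingleton_or_nontrivial A
  · exact ⟨0, 0, 0, .zero _, .zero _, by simp; positivity, by simp, Subsingleton.elim _ _,
      Subsingleton.elim _ _, Subsingleton.elim _ _, Subsingleton.elim _ _,
      fun _ _ => Subsingleton.elim _ _, fun _ _ _ _ => Subsingleton.elim _ _⟩
  have hspec : ∀ x ∈ spectrum ℝ a, |x| ≤ 1 := fun x hx =>
    (spectrum.norm_le_norm_of_mem hx).trans ha1
  have hs : Continuous fun x => sinc (arcsin x) := continuous_sinc.comp continuous_arcsin
  have hm : Continuous fun x : ℝ => √(1 - x ^ 2) := by fun_prop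
  refine ⟨cfc arcsin a, cfc (fun x : ℝ => √(1 - x ^ 2)) a, cfc (fun x => sinc (arcsin x)) a,
    cfc_predicate _ _, cfc_predicate _ _, ?_, ?_, ?_, exp_I_smul_cfc_arcsin ha ha1, ?_, ?_, ?_, ?_⟩
  · exact norm_cfc_le (by positivity) fun x _ =>
      abs_le.2 ⟨neg_pi_div_two_le_arcsin x, arcsin_le_pi_div_two x⟩
  · exact norm_cfc_le zero_le_one fun x _ => abs_sinc_le_one _
  · rw [← cfc_mul _ _ a hs.continuousOn continuous_arcsin.continuousOn]
    conv_rhs => rw [← cfc_id' ℝ a]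
    refine cfc_congr fun x hx => ?_
    have hx1 := abs_le.1 (hspec x hx)
    rcases eq_or_ne (arcsin x) 0 with h | h
    · rw [arcsin_eq_zero_iff.1 h]; simp
    · rw [sinc_of_ne_zero h, div_mul_cancel₀ _ h, sin_arcsin hx1.1 hx1.2]
  · rw [← cfc_mul _ _ a hm.continuousOn hm.continuousOn]
    calc _ = cfc (fun x : ℝ => 1 - x ^ 2) a := by
          refine cfc_congr fun x hx => ?_
          exact Real.mul_self_sqrt (by nlinarith [abs_le.1 (hspec x hx)])
      _ = _ := by rw [cfc_sub .., cfc_const_one .., cfc_pow_id .., sq]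
  · exact ((Commute.refl a).cfc_real _).symm
  · intro x hx
    have h : cfc (fun x : ℝ => √(1 - x ^ 2)) a = cfc (fun x : ℝ => √(1 - x)) (a * a) := by
      rw [← sq, ← cfc_pow_id (R := ℝ) a 2, ← cfc_comp' (fun x : ℝ => √(1 - x)) (fun x => x ^ 2) a]
    rw [h]
    exact hx.cfc_real _
  · exact fun r hr hrr hra => cfc_semiconj_of_odd ha hr hrr hra continuous_arcsin arcsin_neg

end Arcsin

/-! ### The rotation carrying one projection to another -/

section Rotation

variable {A : Type*} [CStarAlgebra A]

/-- With `a = p - q` and `b = 1 - p - q` one has `2p = 1 + a - b`. The product `θ r` anticommutes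
with both `a` and `b`, so only the term `1` contributes to `θ r (2p) + (2p) θ r`. -/
theorem rotation_anticommute {p q r θ m : A} (hrr : r * r = 1)
    (hra : r * (p - q) = -((p - q) * r)) (hrm : r * m = -(1 - p - q))
    (hmr : m * r = -(1 - p - q)) (hrθ : r * θ = -(θ * r)) (haθ : Commute (p - q) θ)
    (hmθ : Commute m θ) :
    θ * r * (p - q) = -((p - q) * (θ * r)) ∧ θ * r * p + p * (θ * r) = θ * r := by
  have hA : θ * r * (p - q) = -((p - q) * (θ * r)) := by
    rw [mul_assoc, hra, mul_neg, ← mul_assoc, ← haθ.eq, mul_assoc]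
  refine ⟨hA, ?_⟩
  have hB : θ * r * (1 - p - q) = -((1 - p - q) * (θ * r)) := by
    have h1 : r * (1 - p - q) = -m := by
      rw [← neg_eq_iff_eq_neg.2 hrm, mul_neg, ← mul_assoc, hrr, one_mul]
    have h2 : (1 - p - q) * (θ * r) = m * θ := by
      rw [← neg_eq_iff_eq_neg.2 hmr, neg_mul, mul_assoc, ← mul_assoc r, hrθ, neg_mul, mul_assoc θ,
        hrr, mul_one, mul_neg, neg_neg]
    rw [mul_assoc, h1, h2, mul_neg, hmθ.eq]
  have h2 : (2 : ℂ) • (θ * r * p + p * (θ * r)) = (2 : ℂ) • (θ * r) := by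
    rw [two_smul, two_smul]
    calc θ * r * p + p * (θ * r) + (θ * r * p + p * (θ * r))
        = (θ * r * (p - q) + (p - q) * (θ * r))
          - (θ * r * (1 - p - q) + (1 - p - q) * (θ * r)) + (θ * r + θ * r) := by noncomm_ring
      _ = _ := by rw [hA, hB]; simp
  exact smul_right_injective A (two_ne_zero (α := ℂ)) h2

/-- For `j = i r` and `η = i θ`, `j² = -1` and `-θ r = η j`. Conjugation by `1 + j` takes `-η` to `η
j`, so `exp (-(θ r))` is conjugate to `exp (-η)`, which is explicit. The computation is done on the
reflections `2p - 1 = a - b` and `2q - 1 = -a - b`. -/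
theorem rotation_conj {p q r θ m : A} (hrr : r * r = 1)
    (hra : r * (p - q) = -((p - q) * r)) (hrm : r * m = -(1 - p - q))
    (hmr : m * r = -(1 - p - q)) (hrθ : r * θ = -(θ * r))
    (hexp : NormedSpace.exp (Complex.I • θ) = m + Complex.I • (p - q)) :
    NormedSpace.exp (-(θ * r)) * p * NormedSpace.exp (θ * r) = q := by
  let +nondep : NormedAlgebra ℚ A := .restrictScalars ℚ ℂ A
  set a := p - q with ha
  set b := 1 - p - q with hb
  set j : A := Complex.I • r with hj
  set η : A := Complex.I • θ with hη
  have hjj : j * j = -1 := by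
    rw [hj, smul_mul_smul_comm, hrr, Complex.I_mul_I, neg_one_smul]
  have hjη : j * η = -(η * j) := by
    rw [hj, hη, smul_mul_smul_comm, smul_mul_smul_comm, hrθ, smul_neg]
  have hja : j * a = -(a * j) := by rw [hj, smul_mul_assoc, hra, mul_smul_comm, smul_neg]
  have hrb : r * b = b * r := by
    have h1 : r * b = -(r * m * r) := by rw [mul_assoc, hmr, mul_neg, neg_neg]
    rw [h1, hrm, neg_mul, neg_neg]
  have hjb : j * b = b * j := by rw [hj, smul_mul_assoc, hrb, mul_smul_comm]
  have hθr : -(θ * r) = η * j := by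
    rw [hj, hη, smul_mul_smul_comm, Complex.I_mul_I, neg_one_smul]
  let v : A := (1 / 2 : ℂ) • (1 - j)
  have huv : (1 + j) * v = 1 := by
    rw [mul_smul_comm, show (1 + j) * (1 - j) = 1 - j * j by noncomm_ring, hjj, sub_neg_eq_add,
      ← two_smul ℂ (1 : A), smul_smul]
    norm_num
  have hvu : v * (1 + j) = 1 := by
    rw [smul_mul_assoc, show (1 - j) * (1 + j) = 1 - j * j by noncomm_ring, hjj, sub_neg_eq_add,
      ← two_smul ℂ (1 : A), smul_smul]
    norm_num
  let u : Aˣ := ⟨1 + j, v, huv, hvu⟩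
  -- Conjugation by `1 + j` is a quarter turn on elements anticommuting with `j`, and trivial on
  -- those commuting with it (`hfix`).
  have hswap : ∀ x : A, j * x = -(x * j) → (1 + j) * x * v = -(x * j) ∧ v * x * (1 + j) = x * j := by
    intro x hx
    constructor
    · rw [mul_smul_comm]
      calc (1 / 2 : ℂ) • ((1 + j) * x * (1 - j))
          = (1 / 2 : ℂ) • (x + j * x - x * j - (j * x) * j) := by congr 1; noncomm_ring
        _ = (1 / 2 : ℂ) • ((2 : ℂ) • (-(x * j))) := by
          congr 1
          rw [hx, neg_mul, mul_assoc, hjj, two_smul]; noncomm_ring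
        _ = _ := by rw [smul_smul]; norm_num
    · rw [smul_mul_assoc, smul_mul_assoc]
      calc (1 / 2 : ℂ) • ((1 - j) * x * (1 + j))
          = (1 / 2 : ℂ) • (x - j * x + x * j - (j * x) * j) := by congr 1; noncomm_ring
        _ = (1 / 2 : ℂ) • ((2 : ℂ) • (x * j)) := by
          congr 1
          rw [hx, neg_mul, mul_assoc, hjj, two_smul]; noncomm_ring
        _ = _ := by rw [smul_smul]; norm_num
  have hfix : ∀ x : A, j * x = x * j → (1 + j) * x * v = x ∧ v * x * (1 + j) = x := by
    intro x hx
    have h1 : (1 + j) * x = x * (1 + j) := by rw [add_mul, hx, mul_add, one_mul, mul_one]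
    constructor
    · rw [h1, mul_assoc, huv, mul_one]
    · rw [mul_assoc, ← h1, ← mul_assoc, hvu, one_mul]
  have hneg : NormedSpace.exp (-(θ * r)) = (1 + j) * NormedSpace.exp (-η) * v := by
    rw [hθr]
    refine Eq.trans ?_ (NormedSpace.exp_units_conj u (-η))
    congr 1
    change η * j = (1 + j) * (-η) * v
    rw [mul_neg, neg_mul, (hswap η hjη).1, neg_neg]
  have hpos : NormedSpace.exp (θ * r) = (1 + j) * NormedSpace.exp η * v := by
    rw [← neg_neg (θ * r), hθr]
    refine Eq.trans ?_ (NormedSpace.exp_units_conj u η)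
    congr 1
    exact ((hswap η hjη).1).symm
  have hinv : NormedSpace.exp (-η) * NormedSpace.exp η = 1 := by
    rw [← NormedSpace.exp_add_of_commute (Commute.refl η).neg_left, neg_add_cancel,
      NormedSpace.exp_zero]
  have haj : a * j = (Complex.I • a) * r := by rw [hj, mul_smul_comm, smul_mul_assoc]
  have hmid : v * (a - b) * (1 + j) = NormedSpace.exp η * r := by
    rw [mul_sub, sub_mul, (hswap a hja).2, (hfix b hjb).2, hexp, add_mul, hmr, haj]
    abel
  have hend : (1 + j) * (r * NormedSpace.exp η) * v = -a - b := by
    have h1 : r * NormedSpace.exp η = -b - a * j := by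
      rw [hexp, mul_add, hrm, haj, mul_smul_comm, hra, smul_neg, smul_mul_assoc, sub_eq_add_neg]
    have h2 : (1 + j) * (a * j) * v = a := by
      have h3 : j * (a * j) = -(a * j * j) := by rw [← mul_assoc, hja, neg_mul]
      rw [(hswap _ h3).1, mul_assoc, hjj, mul_neg, mul_one, neg_neg]
    rw [h1, mul_sub, sub_mul, h2, mul_neg, neg_mul, (hfix b hjb).1]
    abel
  have hexpinv : NormedSpace.exp (-(θ * r)) * NormedSpace.exp (θ * r) = 1 := by
    rw [← NormedSpace.exp_add_of_commute (Commute.refl (θ * r)).neg_left, neg_add_cancel,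
      NormedSpace.exp_zero]
  have hrefl : NormedSpace.exp (-(θ * r)) * (a - b) * NormedSpace.exp (θ * r) = -a - b := by
    calc _ = (1 + j) * NormedSpace.exp (-η) * (v * (a - b) * (1 + j)) * NormedSpace.exp η * v := by
          rw [hneg, hpos]; noncomm_ring
      _ = (1 + j) * ((NormedSpace.exp (-η) * NormedSpace.exp η) * r * NormedSpace.exp η) * v := by
          rw [hmid]; noncomm_ring
      _ = _ := by rw [hinv, one_mul, hend]
  have hp : p = (1 / 2 : ℂ) • (1 + (a - b)) := by
    rw [show 1 + (a - b) = p + p by rw [ha, hb]; abel, ← two_smul ℂ p, smul_smul]; norm_num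
  have hq : q = (1 / 2 : ℂ) • (1 + (-a - b)) := by
    rw [show 1 + (-a - b) = q + q by rw [ha, hb]; abel, ← two_smul ℂ q, smul_smul]; norm_num
  conv_lhs => rw [hp]
  conv_rhs => rw [hq]
  rw [mul_smul_comm, smul_mul_assoc, mul_add, add_mul, mul_one, hexpinv, hrefl]

theorem codiagonal_of_anticommute {R : Type*} [Ring R] {p z : R} (hp : p * p = p)
    (h : z * p + p * z = z) : p * z * p = 0 ∧ (1 - p) * z * (1 - p) = 0 := by
  have h1 : p * z * p = 0 := by
    have h2 : p * (z * p + p * z) = p * z := by rw [h]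
    rw [mul_add, ← mul_assoc, ← mul_assoc, hp] at h2
    simpa using h2
  refine ⟨h1, ?_⟩
  calc (1 - p) * z * (1 - p) = z - (z * p + p * z) + p * z * p := by noncomm_ring
    _ = 0 := by rw [h, h1]; simp

end Rotation

/-! ### Rotations between two projections with infinite-dimensional antipodal part -/

section RotationOperators

open Real

variable {H : Type*} [NormedAddCommGroup H] [InnerProductSpace ℂ H] [CompleteSpace H]

/-- The exponent of a rotation of length at most `π / 2` carrying `P` to `Q`. -/
structure IsRotation (P Q Z : H →L[ℂ] H) : Prop where
  star_eq : star Z = -Z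
  anticomm : Z * P + P * Z = Z
  conj : NormedSpace.exp Z * P * NormedSpace.exp (-Z) = Q
  norm_le : ‖Z‖ ≤ π / 2

theorem IsStarProjection.norm_apply_sq {P : H →L[ℂ] H} (hP : IsStarProjection P) (x : H) :
    ((‖P x‖ : ℂ)) ^ 2 = inner ℂ (P x) x := by
  rw [hP.isSelfAdjoint.norm_apply_sq, hP.isIdempotentElem.eq]

theorem IsStarProjection.norm_apply_le {P : H →L[ℂ] H} (hP : IsStarProjection P) (x : H) :
    ‖P x‖ ≤ ‖x‖ :=
  P.le_of_opNorm_le hP.norm_le x |>.trans_eq (one_mul _)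

/-- Pairing with `x` gives `‖P x‖² - ‖Q x‖² = ‖x‖²`, while `‖P x‖ ≤ ‖x‖`. -/
theorem apply_of_sub_apply_eq_self {P Q : H →L[ℂ] H} (hP : IsStarProjection P)
    (hQ : IsStarProjection Q) {x : H} (hx : (P - Q) x = x) : P x = x ∧ Q x = 0 := by
  have h1 : (‖P x‖ : ℂ) ^ 2 - (‖Q x‖ : ℂ) ^ 2 = (‖x‖ : ℂ) ^ 2 := by
    rw [hP.norm_apply_sq, hQ.norm_apply_sq, ← inner_sub_left, ← sub_apply, hx,
      inner_self_eq_norm_sq_to_K]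
    rfl
  have h2 : ‖P x‖ ^ 2 - ‖Q x‖ ^ 2 = ‖x‖ ^ 2 := by exact_mod_cast h1
  have h3 := hP.norm_apply_le x
  have h4 : Q x = 0 := by
    rw [← norm_eq_zero]
    nlinarith [norm_nonneg (P x), norm_nonneg (Q x), norm_nonneg x]
  rw [sub_apply, h4, sub_zero] at hx
  exact ⟨hx, h4⟩

theorem apply_of_sub_apply_eq_neg {P Q : H →L[ℂ] H} (hP : IsStarProjection P)
    (hQ : IsStarProjection Q) {x : H} (hx : (P - Q) x = -x) : P x = 0 ∧ Q x = x := by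
  refine (apply_of_sub_apply_eq_self hQ hP ?_).symm
  rw [← neg_sub P Q, neg_apply, hx, neg_neg]

/-- Pythagoras, from `(P - Q)² + (1 - P - Q)² = 1`. -/
theorem norm_sub_le_one_of_isStarProjection {P Q : H →L[ℂ] H} (hP : IsStarProjection P)
    (hQ : IsStarProjection Q) : ‖P - Q‖ ≤ 1 := by
  have hA : IsSelfAdjoint (P - Q) := hP.isSelfAdjoint.sub hQ.isSelfAdjoint
  have hB : IsSelfAdjoint (1 - P - Q) := ((IsSelfAdjoint.one _).sub hP.isSelfAdjoint).sub
    hQ.isSelfAdjoint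
  refine ContinuousLinearMap.opNorm_le_bound _ zero_le_one fun x => ?_
  have h : (‖(P - Q) x‖ : ℂ) ^ 2 + (‖(1 - P - Q) x‖ : ℂ) ^ 2 = (‖x‖ : ℂ) ^ 2 := by
    rw [hA.norm_apply_sq, hB.norm_apply_sq, ← inner_add_left, ← add_apply,
      show (P - Q) * (P - Q) + (1 - P - Q) * (1 - P - Q)
        = 1 + ((P * P - P) + (P * P - P) + (Q * Q - Q) + (Q * Q - Q)) by noncomm_ring,
      hP.isIdempotentElem.eq, hQ.isIdempotentElem.eq]
    simp only [sub_self, add_zero]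
    exact inner_self_eq_norm_sq_to_K (𝕜 := ℂ) x
  have h2 : ‖(P - Q) x‖ ^ 2 + ‖(1 - P - Q) x‖ ^ 2 = ‖x‖ ^ 2 := by exact_mod_cast h
  rw [one_mul]
  nlinarith [norm_nonneg ((P - Q) x), norm_nonneg x, sq_nonneg ‖(1 - P - Q) x‖]

/-- The exponent is `-(θ R)`, with `θ = arcsin (P - Q)` and `R` the symmetry of `exists_symmetry`,
prescribed on `N(1 - P - Q)` by a swap of the two antipodal subspaces. The last clause says that `Z`
carries the first of them into the second without shrinking vectors. -/
theorem exists_isRotation [TopologicalSpace.SeparableSpace H] {P Q : H →L[ℂ] H}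
    (hP : IsStarProjection P) (hQ : IsStarProjection Q)
    (hE : ¬ FiniteDimensional ℂ (LinearMap.ker ((P - Q - 1 : H →L[ℂ] H) : H →ₗ[ℂ] H)))
    (hF : ¬ FiniteDimensional ℂ (LinearMap.ker ((P - Q + 1 : H →L[ℂ] H) : H →ₗ[ℂ] H))) :
    ∃ Z : H →L[ℂ] H, IsRotation P Q Z ∧
      ∀ x, (P - Q) x = x → (P - Q) (Z x) = -Z x ∧ ‖x‖ ≤ ‖Z x‖ := by
  set E := LinearMap.ker ((P - Q - 1 : H →L[ℂ] H) : H →ₗ[ℂ] H) with hEdef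
  set F := LinearMap.ker ((P - Q + 1 : H →L[ℂ] H) : H →ₗ[ℂ] H) with hFdef
  have memE : ∀ x, x ∈ E ↔ (P - Q) x = x := fun x => by
    simp [hEdef, sub_eq_zero]
  have memF : ∀ x, x ∈ F ↔ (P - Q) x = -x := fun x => by
    rw [hFdef, LinearMap.mem_ker, ← add_eq_zero_iff_eq_neg]
    rfl
  have hPi := hP.isIdempotentElem.eq
  have hQi := hQ.isIdempotentElem.eq
  have hA : IsSelfAdjoint (P - Q) := hP.isSelfAdjoint.sub hQ.isSelfAdjoint
  have hB : IsSelfAdjoint (1 - P - Q) := ((IsSelfAdjoint.one _).sub hP.isSelfAdjoint).sub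
    hQ.isSelfAdjoint
  have hEF : E ⟂ F := by
    rw [Submodule.isOrtho_iff_inner_eq]
    intro x hx y hy
    have hx1 := (apply_of_sub_apply_eq_self hP hQ ((memE x).1 hx)).1
    have hy1 := (apply_of_sub_apply_eq_neg hP hQ ((memF y).1 hy)).1
    rw [← hx1, ← ContinuousLinearMap.adjoint_inner_right, hP.isSelfAdjoint.adjoint_eq, hy1,
      inner_zero_right]
  obtain ⟨V, hV⟩ := exists_isometric_swap (ContinuousLinearMap.isClosed_ker _)
    (ContinuousLinearMap.isClosed_ker _) hEF hE hF
  have hsq : (1 - P - Q) * (1 - P - Q) = 1 - (P - Q) * (P - Q) := by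
    calc _ = 1 - (P - Q) * (P - Q)
          + ((P * P - P) + (P * P - P) + (Q * Q - Q) + (Q * Q - Q)) := by noncomm_ring
      _ = _ := by simp [hPi, hQi]
  have hAB : (P - Q) * (1 - P - Q) = -((1 - P - Q) * (P - Q)) := by
    rw [← sub_eq_zero]
    calc _ = ((P - P * P) - (Q - Q * Q)) + ((P - P * P) - (Q - Q * Q)) := by noncomm_ring
      _ = _ := by simp [hPi, hQi]
  obtain ⟨θ, M, S, hθ, hM, hθn, hSn, hSθ, hexp, hMM, hAθ, hMcomm, hodd⟩ :=
    exists_arcsin hA (norm_sub_le_one_of_isStarProjection hP hQ)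
  have hMA : Commute M (P - Q) := hMcomm _ ((Commute.refl _).mul_left (Commute.refl _))
  have hMθ : Commute M θ := hMcomm _ (hAθ.mul_left hAθ)
  have hMB : Commute M (1 - P - Q) := hMcomm _ (by
    rw [show (P - Q) * (P - Q) = 1 - (1 - P - Q) * (1 - P - Q) by rw [hsq, sub_sub_cancel]]
    exact (Commute.one_left _).sub_left ((Commute.refl _).mul_left (Commute.refl _)))
  -- `N(1 - P - Q) = E ⊕ F`, with components `P k` and `Q k`. There `P - Q` is `1` on `E` and `-1`
  -- on `F`, so it anticommutes with the swap.
  have hVker : ∀ k, (1 - P - Q) k = 0 → (1 - P - Q) (V k) = 0 ∧ V (V k) = k ∧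
      V ((P - Q) k) = -(P - Q) (V k) ∧ ‖V k‖ = ‖k‖ := by
    intro k hk
    have hk1 : k = P k + Q k := by
      simp only [sub_apply, one_apply_eq_self] at hk
      rw [sub_sub] at hk
      exact sub_eq_zero.1 hk
    have hPP : ∀ x, P (P x) = P x := fun x => DFunLike.congr_fun hPi x
    have hQQ : ∀ x, Q (Q x) = Q x := fun x => DFunLike.congr_fun hQi x
    have hPQ : P (Q k) = 0 := by
      have h := congrArg P hk1
      rw [map_add, hPP] at h
      simpa using h
    have hQP : Q (P k) = 0 := by
      have h := congrArg Q hk1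
      rw [map_add, hQQ] at h
      simpa using h
    have hxE : P k ∈ E := (memE _).2 (by simp [hPP, hQP])
    have hyF : Q k ∈ F := (memF _).2 (by simp [hQQ, hPQ])
    obtain ⟨h1, h2, h3, h4, h5⟩ := hV _ hxE _ hyF
    have hBE : ∀ x ∈ E, (1 - P - Q) x = 0 := fun x hx => by
      have h := apply_of_sub_apply_eq_self hP hQ ((memE x).1 hx)
      simp [h.1, h.2]
    have hBF : ∀ x ∈ F, (1 - P - Q) x = 0 := fun x hx => by
      have h := apply_of_sub_apply_eq_neg hP hQ ((memF x).1 hx)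
      simp [h.1, h.2]
    refine ⟨?_, ?_, ?_, ?_⟩
    · rw [hk1, map_add, map_add, hBF _ h1, hBE _ h2, add_zero]
    · conv_lhs => rw [hk1, map_add, map_add, h3, h4]
      exact hk1.symm
    · conv_rhs => rw [hk1, map_add, map_add, (memF _).1 h1, (memE _).1 h2]
      rw [sub_apply, map_sub]
      abel
    · rw [hk1]
      exact h5
  obtain ⟨R, hR, hRR, hRA, hRM, hMR, hRV⟩ := exists_symmetry hB hM (hMM.trans hsq.symm) hMB.eq
    hMA.eq hAB hVker
  have hRθ := hodd R hR hRR hRA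
  obtain ⟨hanti, hcod⟩ := rotation_anticommute hRR hRA hRM hMR hRθ hAθ hMθ
  have hRnorm : ∀ x, ‖R x‖ = ‖x‖ := by
    refine (ContinuousLinearMap.norm_map_iff_adjoint_comp_self R).2 ?_
    rw [hR.adjoint_eq]
    exact hRR
  refine ⟨-(θ * R), ⟨?_, ?_, ?_, ?_⟩, fun x hx => ⟨?_, ?_⟩⟩
  · rw [star_neg, star_mul, hθ.star_eq, hR.star_eq, hRθ]
  · rw [neg_mul, mul_neg, ← neg_add, hcod]
  · rw [neg_neg]
    exact rotation_conj hRR hRA hRM hMR hRθ hexp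
  · rw [norm_neg]
    refine ContinuousLinearMap.opNorm_le_bound _ (by positivity) fun x => ?_
    rw [mul_apply_eq_comp, ← hRnorm x]
    exact θ.le_of_opNorm_le hθn _
  · have h : (θ * R) ((P - Q) x) = -((P - Q) ((θ * R) x)) := DFunLike.congr_fun hanti x
    rw [hx] at h
    change (P - Q) (-(θ * R) x) = -(-(θ * R) x)
    rw [map_neg, neg_neg]
    exact h.symm
  -- `‖x‖ = ‖(P - Q) R x‖ = ‖S θ R x‖ ≤ ‖θ R x‖`, since `S` is a contraction.
  · have h1 : R ((P - Q) x) = -((P - Q) (R x)) := DFunLike.congr_fun hRA x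
    have h2 : S (θ (R x)) = (P - Q) (R x) := DFunLike.congr_fun hSθ (R x)
    calc ‖x‖ = ‖S (θ (R x))‖ := by rw [h2, ← norm_neg ((P - Q) (R x)), ← h1, hx, hRnorm]
      _ ≤ 1 * ‖θ (R x)‖ := S.le_of_opNorm_le hSn _
      _ = ‖(-(θ * R)) x‖ := by rw [one_mul, neg_apply, norm_neg]; rfl

/-- Every clause is invariant under unitaries that fix `P` and `Q` by conjugation; this is the
source of non-uniqueness. -/
theorem IsRotation.conj_unitary {P Q Z W : H →L[ℂ] H} (hZ : IsRotation P Q Z)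
    (hW : W ∈ unitary (H →L[ℂ] H)) (hWP : Commute W P) (hWQ : Commute W Q) :
    IsRotation P Q (W * Z * star W) := by
  let +nondep : NormedAlgebra ℚ (H →L[ℂ] H) := .restrictScalars ℚ ℂ _
  have h1 : star W * W = 1 := Unitary.star_mul_self_of_mem hW
  have h2 : W * star W = 1 := Unitary.mul_star_self_of_mem hW
  have hP : star W * P = P * star W := by
    calc star W * P = star W * (P * W) * star W := by
          rw [mul_assoc (star W), mul_assoc P, h2, mul_one]
      _ = P * star W := by rw [← hWP.eq, ← mul_assoc, h1, one_mul]
  have hexp : ∀ X : H →L[ℂ] H,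
      NormedSpace.exp (W * X * star W) = W * NormedSpace.exp X * star W := fun X =>
    NormedSpace.exp_units_conj (⟨W, star W, h2, h1⟩ : (H →L[ℂ] H)ˣ) X
  refine ⟨?_, ?_, ?_, ?_⟩
  · rw [star_mul, star_mul, star_star, hZ.star_eq, neg_mul, mul_neg, ← mul_assoc]
  · calc W * Z * star W * P + P * (W * Z * star W)
        = W * Z * (star W * P) + (P * W) * Z * star W := by noncomm_ring
      _ = W * (Z * P + P * Z) * star W := by rw [hP, ← hWP.eq]; noncomm_ring
      _ = _ := by rw [hZ.anticomm]
  · rw [show -(W * Z * star W) = W * (-Z) * star W by noncomm_ring, hexp, hexp]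
    calc W * NormedSpace.exp Z * star W * P * (W * NormedSpace.exp (-Z) * star W)
        = W * NormedSpace.exp Z * (star W * P) * W * NormedSpace.exp (-Z) * star W := by
          noncomm_ring
      _ = W * (NormedSpace.exp Z * P * (star W * W) * NormedSpace.exp (-Z)) * star W := by
          rw [hP]; noncomm_ring
      _ = Q := by rw [h1, mul_one, hZ.conj, hWQ.eq, mul_assoc, h2, mul_one]
  · have h3 : ∀ X : H →L[ℂ] H, ‖W * X‖ = ‖X‖ := fun X => CStarRing.norm_mem_unitary_mul X hW
    rw [CStarRing.norm_mul_mem_unitary _ (Unitary.star_mem hW), h3]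
    exact hZ.norm_le

/-- A circle of rotations from `P` to `Q`, which turn the antipodal part with different phases. -/
theorem exists_isRotation_circle [TopologicalSpace.SeparableSpace H] {P Q : H →L[ℂ] H}
    (hP : IsStarProjection P) (hQ : IsStarProjection Q)
    (hE : ¬ FiniteDimensional ℂ (LinearMap.ker ((P - Q - 1 : H →L[ℂ] H) : H →ₗ[ℂ] H)))
    (hF : ¬ FiniteDimensional ℂ (LinearMap.ker ((P - Q + 1 : H →L[ℂ] H) : H →ₗ[ℂ] H))) :
    ∃ Z : Circle → (H →L[ℂ] H), (∀ c, IsRotation P Q (Z c)) ∧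
      ∀ (c d : Circle) (x : H), (P - Q) x = x → ‖(c : ℂ) - d‖ * ‖x‖ ≤ ‖(Z c - Z d) x‖ := by
  obtain ⟨Z, hZ, hZE⟩ := exists_isRotation hP hQ hE hF
  set F := LinearMap.ker ((P - Q + 1 : H →L[ℂ] H) : H →ₗ[ℂ] H) with hFdef
  have memF : ∀ x, x ∈ F ↔ (P - Q) x = -x := fun x => by
    rw [hFdef, LinearMap.mem_ker, ← add_eq_zero_iff_eq_neg]
    rfl
  have : CompleteSpace F :=
    (ContinuousLinearMap.isClosed_ker (P - Q + 1 : H →L[ℂ] H)).completeSpace_coe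
  obtain ⟨p, hp⟩ : ∃ p : H →L[ℂ] H, p = F.starProjection := ⟨_, rfl⟩
  have hpsp : IsStarProjection p := hp ▸ isStarProjection_starProjection
  have hpi := hpsp.isIdempotentElem.eq
  have hps := hpsp.isSelfAdjoint.star_eq
  have hpF : ∀ x, (P - Q) (p x) = -p x := fun x => (memF _).1 (by
    rw [hp]; exact Submodule.starProjection_apply_mem _ _)
  have hPp : P * p = 0 := ContinuousLinearMap.ext fun x =>
    (apply_of_sub_apply_eq_neg hP hQ (hpF x)).1
  have hQp : Q * p = p := ContinuousLinearMap.ext fun x =>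
    (apply_of_sub_apply_eq_neg hP hQ (hpF x)).2
  have hpP : p * P = 0 := by
    have h := congrArg star hPp
    rwa [star_mul, hps, hP.isSelfAdjoint.star_eq, star_zero] at h
  have hpQ : p * Q = p := by
    have h := congrArg star hQp
    rwa [star_mul, hps, hQ.isSelfAdjoint.star_eq] at h
  -- Phase `c` on `F`, identity on its complement. As `P = 0` and `Q = 1` on `F`, it commutes with
  -- both.
  let W : Circle → (H →L[ℂ] H) := fun c => 1 - p + (c : ℂ) • p
  have hWs : ∀ c, star (W c) = 1 - p + (starRingEnd ℂ (c : ℂ)) • p := fun c => by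
    simp only [W, star_add, star_sub, star_one, star_smul, hps]
    rfl
  have hmul : ∀ a b : ℂ, a * b = 1 → (1 - p + a • p) * (1 - p + b • p) = 1 := fun a b hab => by
    have h1 : (1 - p) * p = 0 := by rw [sub_mul, one_mul, hpi, sub_self]
    have h2 : p * (1 - p) = 0 := by rw [mul_sub, mul_one, hpi, sub_self]
    have h3 : (1 - p) * (1 - p) = 1 - p := by rw [mul_sub, mul_one, h1, sub_zero]
    rw [add_mul, mul_add, mul_add, smul_mul_smul_comm, smul_mul_assoc, mul_smul_comm, h1, h2, h3,
      hpi, hab, one_smul, smul_zero, smul_zero, add_zero, zero_add, sub_add_cancel]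
  have hcc : ∀ c : Circle, (c : ℂ) * starRingEnd ℂ (c : ℂ) = 1 := fun c => by
    rw [Complex.mul_conj, Circle.normSq_coe, Complex.ofReal_one]
  have hW : ∀ c, W c ∈ unitary (H →L[ℂ] H) := fun c => by
    rw [Unitary.mem_iff, hWs]
    exact ⟨hmul _ _ (by rw [mul_comm, hcc]), hmul _ _ (hcc c)⟩
  have hWP : ∀ c, Commute (W c) P := fun c =>
    ((Commute.one_left P).sub_left (hpP.trans hPp.symm)).add_left
      (Commute.smul_left (hpP.trans hPp.symm) _)
  have hWQ : ∀ c, Commute (W c) Q := fun c =>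
    ((Commute.one_left Q).sub_left (hpQ.trans hQp.symm)).add_left
      (Commute.smul_left (hpQ.trans hQp.symm) _)
  -- `star (W c)` fixes `x ∈ E`, and `Z x` lies in `F`, where `W c` multiplies by `c`.
  have hact : ∀ c x, (P - Q) x = x → (W c * Z * star (W c)) x = (c : ℂ) • Z x := fun c x hx => by
    have h1 : p x = 0 := by
      have h := apply_of_sub_apply_eq_self hP hQ hx
      rw [← h.1]
      exact DFunLike.congr_fun hpP x
    have h2 : p (Z x) = Z x := by
      rw [hp]
      exact Submodule.starProjection_eq_self_iff.2 ((memF _).2 (hZE x hx).1)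
    rw [mul_apply_eq_comp, hWs]
    simp [W, h1, h2]
  refine ⟨fun c => W c * Z * star (W c), fun c => hZ.conj_unitary (hW c) (hWP c) (hWQ c),
    fun c d x hx => ?_⟩
  rw [sub_apply, hact c x hx, hact d x hx, ← sub_smul, norm_smul]
  gcongr
  exact (hZE x hx).2

end RotationOperators

/-! ### Minimal geodesics of the Calkin algebra -/

section CalkinGeodesics

open Real Filter Topology

variable {H : Type*} [NormedAddCommGroup H] [InnerProductSpace ℂ H]

/-- A state of the Calkin algebra taking prescribed values at common eigenvectors `e n`. -/
theorem exists_calkin_state_of_eigenvectors [CompleteSpace H] {e : ℕ → H} (he : Orthonormal ℂ e) :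
    ∃ φ : Calkin H →L[ℝ] ℝ, φ 1 = 1 ∧ (∀ x, IsStarProjection x → 0 ≤ φ x) ∧
      (∀ x z, IsStarProjection x → IsStarProjection z → ∀ y,
        |φ (x * y * z)| ≤ √(φ x) * ‖y‖ * √(φ z)) ∧
      ∀ (T : H →L[ℂ] H) (c : ℝ), (∀ n, T (e n) = (c : ℂ) • e n) → φ (Calkin.mk H T) = c := by
  obtain ⟨φ, hφ⟩ := exists_calkin_state he
  have hscalar : ∀ (T : H →L[ℂ] H) (c : ℝ), (∀ n, T (e n) = (c : ℂ) • e n) →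
      φ (Calkin.mk H T) = c := fun T c hT => by
    refine tendsto_nhds_unique (hφ T) (tendsto_const_nhds.congr fun n => ?_)
    rw [hT, inner_smul_right, inner_self_eq_norm_sq_to_K, he.1 n]
    simp
  refine ⟨φ, ?_, fun x hx => ?_, fun x z hx hz => calkin_state_mul_mul_le hφ hx hz, hscalar⟩
  · have h := hscalar 1 1 fun n => by simp
    rwa [map_one] at h
  · obtain ⟨X, rfl⟩ := Calkin.mk_surjective x
    have h1 : Calkin.mk H (star X * X) = Calkin.mk H X := by
      rw [map_mul, ← Calkin.star_mk, hx.isSelfAdjoint.star_eq, hx.isIdempotentElem.eq]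
    have h2 := hφ (star X * X)
    rw [h1] at h2
    refine ge_of_tendsto' h2 fun n => ?_
    rw [mul_apply_eq_comp, ContinuousLinearMap.star_eq_adjoint,
      ContinuousLinearMap.adjoint_inner_right]
    exact inner_self_nonneg (𝕜 := ℂ)

variable [CompleteSpace H]

/-- The quotient map, as a continuous real-linear map. -/
noncomputable def Calkin.mkCLM (H : Type*) [NormedAddCommGroup H] [InnerProductSpace ℂ H] [CompleteSpace H] :
    (H →L[ℂ] H) →L[ℝ] Calkin H :=
  LinearMap.mkContinuous ((Calkin.mk H).toLinearMap.restrictScalars ℝ) 1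
    fun T => by rw [one_mul]; exact Calkin.norm_mk_le T

theorem Calkin.mk_exp (T : H →L[ℂ] H) :
    Calkin.mk H (NormedSpace.exp T) = NormedSpace.exp (Calkin.mk H T) := by
  let +nondep : NormedAlgebra ℚ (H →L[ℂ] H) := .restrictScalars ℚ ℂ _
  let +nondep : NormedAlgebra ℚ (Calkin H) := .restrictScalars ℚ ℂ _
  exact NormedSpace.map_exp (Calkin.mk H) (Calkin.mkCLM H).continuous T

/-- The geodesic issued from `π(P)` with velocity `π(Z)`. -/
noncomputable def calkinGeodesic (P Z : H →L[ℂ] H) (t : ℝ) : Calkin H :=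
  NormedSpace.exp (t • Calkin.mk H Z) * Calkin.mk H P * NormedSpace.exp (-(t • Calkin.mk H Z))

theorem calkinGeodesic_eq_mk (P Z : H →L[ℂ] H) (t : ℝ) :
    calkinGeodesic P Z t
      = Calkin.mk H (NormedSpace.exp (t • Z) * P * NormedSpace.exp (t • (-Z))) := by
  have h : t • Calkin.mk H Z = Calkin.mk H (t • Z) := ((Calkin.mkCLM H).map_smul t Z).symm
  rw [calkinGeodesic, h, ← map_neg, ← Calkin.mk_exp, ← Calkin.mk_exp, ← map_mul, ← map_mul,
    smul_neg]

theorem hasDerivAt_calkinGeodesic (P Z : H →L[ℂ] H) (t : ℝ) :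
    HasDerivAt (calkinGeodesic P Z)
      (Calkin.mk H (NormedSpace.exp (t • Z) * (Z * P - P * Z) * NormedSpace.exp (t • (-Z)))) t := by
  have h1 := ((hasDerivAt_exp_smul_const (𝕂 := ℝ) Z t).mul_const P).mul
    (hasDerivAt_exp_smul_const' (𝕂 := ℝ) (-Z) t)
  have h2 := (Calkin.mkCLM H).hasFDerivAt.comp_hasDerivAt t h1
  have h3 : calkinGeodesic P Z = fun s => Calkin.mkCLM H
      (NormedSpace.exp (s • Z) * P * NormedSpace.exp (s • (-Z))) :=
    funext (calkinGeodesic_eq_mk P Z)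
  rw [h3]
  refine h2.congr_deriv ?_
  change Calkin.mk H _ = Calkin.mk H _
  congr 1
  noncomm_ring

/-- Up to unitary factors the velocity lifts to `Z P - P Z = Z (2P - 1)`, whose norm is at most
`‖Z‖`. -/
theorem IsRotation.norm_deriv_calkinGeodesic_le {P Q Z : H →L[ℂ] H} (hP : IsStarProjection P)
    (hZ : IsRotation P Q Z) (t : ℝ) : ‖deriv (calkinGeodesic P Z) t‖ ≤ π / 2 := by
  let +nondep : NormedAlgebra ℚ (H →L[ℂ] H) := .restrictScalars ℚ ℂ _
  rw [(hasDerivAt_calkinGeodesic P Z t).deriv]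
  refine (Calkin.norm_mk_le _).trans ?_
  have hu : ∀ s : ℝ, NormedSpace.exp (s • Z) ∈ unitary (H →L[ℂ] H) := fun s =>
    NormedSpace.exp_mem_unitary_of_mem_skewAdjoint
      (by rw [skewAdjoint.mem_iff, star_smul, hZ.star_eq, star_trivial, smul_neg])
  rw [smul_neg, ← neg_smul, CStarRing.norm_mul_mem_unitary _ (hu _),
    CStarRing.norm_mem_unitary_mul _ (hu _)]
  have h1 : Z * P - P * Z = Z * (P - (1 - P)) := by
    calc Z * P - P * Z = Z * P + Z * P - (Z * P + P * Z) := by abel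
      _ = Z * P + Z * P - Z := by rw [hZ.anticomm]
      _ = _ := by noncomm_ring
  rw [h1]
  calc ‖Z * (P - (1 - P))‖ ≤ ‖Z‖ * ‖P - (1 - P)‖ := norm_mul_le _ _
    _ ≤ π / 2 * 1 := by
      gcongr
      exacts [hZ.norm_le, norm_sub_le_one_of_isStarProjection hP hP.one_sub]
    _ = π / 2 := mul_one _

/-- Its length is at most `π/2`, and the limit state along `e` takes the values `1` at `π(P)` and
`0` at `π(Q)`, so no competitor is shorter than `π/2`. -/
theorem IsRotation.isMinimalGeodesicJoining {P Q Z : H →L[ℂ] H} (hP : IsStarProjection P)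
    (hQ : IsStarProjection Q) (hZ : IsRotation P Q Z) {e : ℕ → H} (he : Orthonormal ℂ e)
    (heE : ∀ n, (P - Q) (e n) = e n) :
    IsMinimalGeodesicJoining (Calkin.mk H P) (Calkin.mk H Q) (calkinGeodesic P Z) := by
  have hPQ := fun n => apply_of_sub_apply_eq_self hP hQ (heE n)
  have hp : IsStarProjection (Calkin.mk H P) :=
    ⟨hP.isIdempotentElem.map (Calkin.mk H), by
      rw [IsSelfAdjoint, Calkin.star_mk, hP.isSelfAdjoint.star_eq]⟩
  refine ⟨⟨Calkin.mk H P, Calkin.mk H Z, hp, ⟨?_, ?_⟩, fun t => rfl⟩, ?_, ?_, ?_⟩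
  · rw [Calkin.star_mk, hZ.star_eq, map_neg]
  · exact codiagonal_of_anticommute hp.isIdempotentElem.eq
      (by rw [← map_mul, ← map_mul, ← map_add, hZ.anticomm])
  · simp [calkinGeodesic]
  · rw [calkinGeodesic_eq_mk, one_smul, one_smul, hZ.conj]
  · intro γ a b _ hγ hproj ha hb
    obtain ⟨φ, hφ1, hφ0, hφ, hφe⟩ := exists_calkin_state_of_eigenvectors he
    have hlow := ofReal_pi_div_two_le_curveLength hφ1 hφ0 hφ hγ hproj
      (by rw [ha]; exact_mod_cast hφe P 1 fun n => by simp [(hPQ n).1])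
      (by rw [hb]; exact_mod_cast hφe Q 0 fun n => by simp [(hPQ n).2])
    refine le_trans ?_ hlow
    calc curveLength (calkinGeodesic P Z) 0 1
        ≤ ∫⁻ _ in Set.Icc (0 : ℝ) 1, ENNReal.ofReal (π / 2) := by
          refine MeasureTheory.lintegral_mono fun t => ?_
          rw [← ofReal_norm]
          exact ENNReal.ofReal_le_ofReal (hZ.norm_deriv_calkinGeodesic_le hP t)
      _ = ENNReal.ofReal (π / 2) := by simp

/-- If two geodesics agree on `[0, 1]`, their exponents nearly agree at some vector of any
orthonormal sequence in the range of `P`. -/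
theorem IsRotation.exists_norm_sub_lt {P Q Z Z' : H →L[ℂ] H}
    (hZ : IsRotation P Q Z) (hZ' : IsRotation P Q Z') {e : ℕ → H} (he : Orthonormal ℂ e)
    (heP : ∀ n, P (e n) = e n)
    (heq : Set.EqOn (calkinGeodesic P Z) (calkinGeodesic P Z') (Set.Icc 0 1))
    {ε : ℝ} (hε : 0 < ε) : ∃ n, ‖(Z - Z') (e n)‖ < ε := by
  have h0 : (0 : ℝ) ∈ Set.Icc (0 : ℝ) 1 := ⟨le_rfl, zero_le_one⟩
  -- The curves agree only on `[0, 1]`, so one-sided derivatives at `0` are compared. Their equality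
  -- makes `(Z P - P Z) - (Z' P - P Z')` compact.
  have hd := (uniqueDiffOn_Icc (zero_lt_one' ℝ) 0 h0).eq_deriv _
    ((hasDerivAt_calkinGeodesic P Z 0).hasDerivWithinAt (s := Set.Icc 0 1))
    (((hasDerivAt_calkinGeodesic P Z' 0).hasDerivWithinAt (s := Set.Icc 0 1)).congr heq
      (heq h0))
  simp only [zero_smul, NormedSpace.exp_zero, one_mul, mul_one] at hd
  have hlim := (he.tendsto_compact (Calkin.mk_eq_mk_iff.1 hd)).norm
  rw [norm_zero] at hlim
  obtain ⟨n, hn⟩ := (hlim.eventually_lt_const hε).exists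
  -- Codiagonality gives `P Y e = 0` for `e` in the range of `P`, so the commutator acts there as
  -- `Y`.
  have hval : ∀ {Y : H →L[ℂ] H}, IsRotation P Q Y → (Y * P - P * Y) (e n) = Y (e n) :=
    fun {Y} hY => by
      have h1 : Y (P (e n)) + P (Y (e n)) = Y (e n) := DFunLike.congr_fun hY.anticomm (e n)
      rw [heP n, add_eq_left] at h1
      rw [sub_apply, mul_apply_eq_comp, mul_apply_eq_comp, heP n, h1, sub_zero]
  refine ⟨n, ?_⟩
  rwa [sub_apply, hval hZ, hval hZ', ← sub_apply] at hn

end CalkinGeodesics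

theorem Circle.infinite : Infinite Circle :=
  have := (Set.Ioc_infinite (neg_lt_self Real.pi_pos)).to_subtype
  Infinite.of_injective _ Circle.argEquiv.symm.injective

theorem mainTheorem3 (H : Type*) [NormedAddCommGroup H] [InnerProductSpace ℂ H] [CompleteSpace H]
    [TopologicalSpace.SeparableSpace H] (p q : Calkin H)
    (hp : IsStarProjection p) (hq : IsStarProjection q)
    (hPQ : ∃ P Q : H →L[ℂ] H, IsStarProjection P ∧ IsStarProjection Q ∧
      Calkin.mk H P = p ∧ Calkin.mk H Q = q ∧
      ¬ FiniteDimensional ℂ (LinearMap.ker ((P - Q - 1 : H →L[ℂ] H) : H →ₗ[ℂ] H)) ∧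
      ¬ FiniteDimensional ℂ (LinearMap.ker ((P - Q + 1 : H →L[ℂ] H) : H →ₗ[ℂ] H))) :
    ((fun δ : ℝ → Calkin H => (Set.Icc (0 : ℝ) 1).domRestrict δ) ''
      {δ | IsMinimalGeodesicJoining p q δ}).Infinite := by
  obtain ⟨P, Q, hP, hQ, rfl, rfl, hE, hF⟩ := hPQ
  obtain ⟨Z, hZ, hZcd⟩ := exists_isRotation_circle hP hQ hE hF
  have : CompleteSpace (LinearMap.ker ((P - Q - 1 : H →L[ℂ] H) : H →ₗ[ℂ] H)) :=
    (ContinuousLinearMap.isClosed_ker (P - Q - 1 : H →L[ℂ] H)).completeSpace_coe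
  have : SecondCountableTopology H := UniformSpace.secondCountable_of_separable H
  -- This sequence in `E` serves twice: it defines the state proving minimality, and it detects that
  -- `Z c - Z d` is not compact.
  obtain ⟨b⟩ := exists_hilbertBasis_nat _ hE
  have he : Orthonormal ℂ fun n => (b n : H) := b.orthonormal.comp_linearIsometry
    (LinearMap.ker ((P - Q - 1 : H →L[ℂ] H) : H →ₗ[ℂ] H)).subtypeₗᵢ
  have heE : ∀ n, (P - Q) (b n : H) = b n := fun n => sub_eq_zero.1 (b n).2
  have := Circle.infinite
  refine Set.infinite_of_injective_forall_mem
    (f := fun c : Circle => (Set.Icc (0 : ℝ) 1).domRestrict (calkinGeodesic P (Z c)))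
    (fun c d hcd => ?_)
    fun c => ⟨_, (hZ c).isMinimalGeodesicJoining hP hQ he heE, rfl⟩
  by_contra hne
  have hpos : 0 < ‖(c : ℂ) - d‖ := norm_pos_iff.2 (sub_ne_zero.2 fun h => hne (Circle.ext h))
  obtain ⟨n, hn⟩ := (hZ c).exists_norm_sub_lt (hZ d) he
    (fun n => (apply_of_sub_apply_eq_self hP hQ (heE n)).1)
    (Set.domRestrict_eq_domRestrict_iff.1 hcd) hpos
  have h1 := hZcd c d _ (heE n)
  rw [he.1 n, mul_one] at h1
  exact absurd hn (not_lt.2 h1)
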